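/- Let $\mathfrak h=\{z\in\mathbb C\mid \operatorname{Im} z>0\}$, on which $\mathbf{SL}(2;\mathbb R)$ acts on the right by $z\cdot\begin{pmatrix}a&c\\b&d\end{pmatrix}=\frac{az+b}{cz+d}$. For $x\in\mathfrak h$ let $G_x$ denote the stabiliser of $x$ in $G:=\mathbf{SL}(2;\mathbb Z)$, and call *slice at $x$* an open neighbourhood $U_x$ of $x$ in $\mathfrak h$ such that $U_x\cdot g\subset U_x$ for all $g\in G_x$ and $(U_x\cdot g)\cap U_x=\emptyset$ for all $g\in G\setminus G_x$. Let $\mathcal{A}n$ be the category of complex analytic manifolds (finite-dimensional, Hausdorff, second countable) and holomorphic maps. For a discrete group $\Gamma$ acting on the right by automorphisms on a manifold $X\in\mathcal{A}n$, the quotient stack $[X/\Gamma]$ is the category fibred in groupoids over $\mathcal{A}n$ whose objects over $S$ are the pairs $(P,u)$ consisting of a principal $\Gamma$-bundle $P\to S$ and a $\Gamma$-equivariant holomorphic map $u:P\to X$. A morphism of stacks $F:\mathcal Y\to\mathcal X$ on $\mathcal{A}n$ is *representable* if for every $S\in\mathcal{A}n$ and every morphism $S\to\mathcal X$ the fibre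 product $S\times_{\mathcal X}\mathcal Y$ is equivalent to a manifold $M_S$. A representable $F$ is a *submersion* if all the induced maps $M_S\to S$ are submersions, and it is an *open substack* of $\mathcal X$ if all these maps are open. $F$ is *surjective* if every object of $\mathcal X(S)$ is, locally on $S$, isomorphic to the image of an object of $\mathcal Y$. An *analytic stack* is a stack $\mathcal X$ on $\mathcal{A}n$ with a representable surjective submersion $X\to\mathcal X$ from a manifold $X$ (a presentation). An *analytic orbifold* is an analytic stack $\mathcal X$ with a family of open substacks $F_i:[U_i/\Gamma_i]\to\mathcal X$, where each $\Gamma_i$ is a finite group acting on a manifold $U_i$ by automorphisms, such that $\bigsqcup_i[U_i/\Gamma_i]\to\mathcal X$ is surjective. Then: 1. The map $g\mapsto i\cdot g$ induces a homeomorphism $\mathbf{SO}(2)\backslash\mathbf{SL}(2;\mathbb R)\simeq\mathfrak h$. The group $\mathbf{SL}(2;\mathbb Z)$ is a discrete subgroup of $\mathbf{SL}(2;\mathbb R)$ and acts properly on $\mathfrak h$: for every compact $C\subset\mathfrak h$, the set $\{g\in\mathbf{SL}(2;\mathbb Z)\mid C\cdot g\cap C\neq\emptyset\}$ is finite. The action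 is not effective: $-I\neq I$ acts trivially. 2. For all $x\in\mathfrak h$, the group $G_x$ is finite and there exists a slice at $x$. 3. The quotient stack $[\mathfrak h/\mathbf{SL}(2;\mathbb Z)]$ has a canonical structure of analytic orbifold. More precisely, it is a stack, and the canonical morphism $\mathfrak h\to[\mathfrak h/\mathbf{SL}(2;\mathbb Z)]$, defined by the trivial bundle $\mathfrak h\times\mathbf{SL}(2;\mathbb Z)$ and the action map, is a presentation of it as an analytic stack. Moreover, for every family of slices $(U_x)_{x\in\mathfrak h}$, the canonical morphisms $[U_x/G_x]\to[\mathfrak h/\mathbf{SL}(2;\mathbb Z)]$, $(P,u)\mapsto P\times_{G_x}\mathbf{SL}(2;\mathbb Z)$ (with the induced map to $\mathfrak h$), exist and make it an analytic orbifold. -/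

import Mathlib

open CategoryTheory TopologicalSpace MulOpposite
open scoped Manifold ContDiff MatrixGroups UpperHalfPlane

universe v

noncomputable section

/-! ## The category `An` of complex analytic manifolds -/

/-- A (finite-dimensional, Hausdorff, second countable) complex analytic manifold, modelled on the
finite-dimensional complex vector space `E`. -/
structure AnMan : Type 1 where
  carrier : Type
  E : Type
  [normedAddCommGroup : NormedAddCommGroup E]
  [normedSpace : NormedSpace ℂ E]
  [finiteDimensional : FiniteDimensional ℂ E]
  [topologicalSpace : TopologicalSpace carrier]
  [t2Space : T2Space carrier]
  [secondCountable : SecondCountableTopology carrier]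
  [chartedSpace : ChartedSpace E carrier]
  [isManifold : IsManifold 𝓘(ℂ, E) ω carrier]

namespace AnMan

instance : CoeSort AnMan Type := ⟨AnMan.carrier⟩

attribute [instance] normedAddCommGroup normedSpace finiteDimensional topologicalSpace t2Space
  secondCountable chartedSpace isManifold

/-- Holomorphic maps. -/
@[ext]
structure Hom (X Y : AnMan) : Type where
  toFun : X → Y
  contMDiff : ContMDiff 𝓘(ℂ, X.E) 𝓘(ℂ, Y.E) ω toFun

instance : Category AnMan where
  Hom := Hom
  id X := ⟨id, contMDiff_id⟩
  comp f g := ⟨g.toFun ∘ f.toFun, g.contMDiff.comp f.contMDiff⟩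

instance (X Y : AnMan) : CoeFun (X ⟶ Y) (fun _ => X → Y) := ⟨Hom.toFun⟩

@[ext]
theorem hom_ext {X Y : AnMan} {f g : X ⟶ Y} (h : ∀ x, f x = g x) : f = g :=
  Hom.ext (funext h)

@[simp] theorem id_apply {X : AnMan} (x : X) : (𝟙 X : X ⟶ X) x = x := rfl

@[simp] theorem comp_apply {X Y Z : AnMan} (f : X ⟶ Y) (g : Y ⟶ Z) (x : X) :
    (f ≫ g) x = g (f x) := rfl

/-- An open subset of a manifold, as a manifold. -/
def restrict (S : AnMan) (U : Opens S) : AnMan where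
  carrier := U
  E := S.E

/-- The inclusion of an open subset. -/
def incl (S : AnMan) (U : Opens S) : S.restrict U ⟶ S :=
  ⟨fun x => x.1, contMDiff_subtype_val (I := 𝓘(ℂ, S.E)) (U := U)⟩

/-- The inclusion of an open subset in a larger one. -/
def inclLE (S : AnMan) {U V : Opens S} (h : U ≤ V) : S.restrict U ⟶ S.restrict V :=
  ⟨Opens.inclusion h, contMDiff_inclusion (I := 𝓘(ℂ, S.E)) h⟩

/-- A submersion in `An`: a holomorphic map all of whose differentials are surjective. -/
def IsSubmersion {X Y : AnMan} (f : X ⟶ Y) : Prop :=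
  ∀ x : X, Function.Surjective (mfderiv 𝓘(ℂ, X.E) 𝓘(ℂ, Y.E) f x)

/-- An open morphism in `An`. -/
def IsOpenMorphism {X Y : AnMan} (f : X ⟶ Y) : Prop := IsOpenMap f

end AnMan

/-! ## Prestacks and stacks on `An`

Prestacks (2-functors from `An` to groupoids) are presented as categories fibred in groupoids
`𝒳.p : 𝒳.obj ⥤ An`; the objects over `S` form the groupoid `𝒳(S)`, a morphism `B ⟶ A` over
`f : T ⟶ S` exhibits `B` as a pullback `f^* A`. Morphisms of prestacks are the functors
over `An`, denoted `𝒳 ⥤ᵇ 𝒴`. -/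

open scoped CategoryTheory.BasedFunctor

/-- A category over `An`. -/
abbrev OverAn := BasedCategory.{0, 1} AnMan

/-- `𝒳` is fibred in groupoids over `An`. -/
structure IsFibredInGroupoids (𝒳 : OverAn) : Prop where
  /-- existence of pullbacks -/
  exists_pullback : ∀ (A : 𝒳.obj) {T : AnMan} (f : T ⟶ 𝒳.p.obj A),
    ∃ (B : 𝒳.obj) (r : B ⟶ A), 𝒳.p.IsHomLift f r
  /-- every morphism of `𝒳` is cartesian -/
  existsUnique_lift : ∀ {A B C : 𝒳.obj} (r : B ⟶ A) (s : C ⟶ A) (h : 𝒳.p.obj C ⟶ 𝒳.p.obj B),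
    h ≫ 𝒳.p.map r = 𝒳.p.map s → ∃! t : C ⟶ B, 𝒳.p.map t = h ∧ t ≫ r = s

/-- `𝒳` is a stack on `An`. Restrictions are not chosen: a morphism `A' ⟶ A` over an open inclusion
exhibits `A'` as the restriction of `A`. -/
structure IsStack (𝒳 : OverAn) : Prop where
  isFibredInGroupoids : IsFibredInGroupoids 𝒳
  /-- Gluing of morphisms. The objects `A' i` are the restrictions of `A` to an open
  covering `U i` of `S`, the morphisms `φ i` (equivalent to morphisms from `A|U i` to `B|U i`)
  agree on the overlaps. -/
  glue_hom : ∀ (S : AnMan) {ι : Type} (U : ι → Opens S), ⨆ i, U i = ⊤ →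
    ∀ (A B : 𝒳.obj), 𝒳.p.obj A = S → 𝒳.p.obj B = S →
    ∀ (A' : ι → 𝒳.obj) (r : ∀ i, A' i ⟶ A) (φ : ∀ i, A' i ⟶ B),
    (∀ i, 𝒳.p.IsHomLift (S.incl (U i)) (r i)) →
    (∀ i, 𝒳.p.IsHomLift (S.incl (U i)) (φ i)) →
    (∀ i j (C : 𝒳.obj) (s : C ⟶ A' i) (t : C ⟶ A' j),
      𝒳.p.IsHomLift (S.inclLE (inf_le_left : U i ⊓ U j ≤ U i)) s →
      𝒳.p.IsHomLift (S.inclLE (inf_le_right : U i ⊓ U j ≤ U j)) t →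
      s ≫ r i = t ≫ r j → s ≫ φ i = t ≫ φ j) →
    ∃! ψ : A ⟶ B, 𝒳.p.IsHomLift (𝟙 S) ψ ∧ ∀ i, r i ≫ ψ = φ i
  /-- Gluing of objects. A descent datum consists of objects `A i` over `U i` and isomorphisms
  between the restrictions of `A j` and `A i` to `U i ⊓ U j`, given by an object `Z i j` over
  `U i ⊓ U j` which is a restriction of `A i` via `a i j` and of `A j` via `b i j`. -/
  glue_obj : ∀ (S : AnMan) {ι : Type} (U : ι → Opens S), ⨆ i, U i = ⊤ →
    ∀ (A : ι → 𝒳.obj) (Z : ι → ι → 𝒳.obj) (a : ∀ i j, Z i j ⟶ A i) (b : ∀ i j, Z i j ⟶ A j),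
    (∀ i, 𝒳.p.obj (A i) = S.restrict (U i)) →
    (∀ i j, 𝒳.p.IsHomLift (S.inclLE (inf_le_left : U i ⊓ U j ≤ U i)) (a i j)) →
    (∀ i j, 𝒳.p.IsHomLift (S.inclLE (inf_le_right : U i ⊓ U j ≤ U j)) (b i j)) →
    (∀ i, a i i = b i i) →
    (∀ i j k (W : 𝒳.obj) (s : W ⟶ Z i j) (t : W ⟶ Z j k) (u : W ⟶ Z i k),
      𝒳.p.IsHomLift (S.inclLE (inf_le_left : U i ⊓ U j ⊓ U k ≤ U i ⊓ U j)) s →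
      𝒳.p.IsHomLift (S.inclLE (inf_le_inf_right (U k) inf_le_right :
        U i ⊓ U j ⊓ U k ≤ U j ⊓ U k)) t →
      𝒳.p.IsHomLift (S.inclLE (inf_le_inf_right (U k) inf_le_left :
        U i ⊓ U j ⊓ U k ≤ U i ⊓ U k)) u →
      s ≫ a i j = u ≫ a i k → s ≫ b i j = t ≫ a j k → t ≫ b j k = u ≫ b i k) →
    ∃ (X : 𝒳.obj) (ρ : ∀ i, A i ⟶ X), 𝒳.p.obj X = S ∧
      (∀ i, 𝒳.p.IsHomLift (S.incl (U i)) (ρ i)) ∧ ∀ i j, a i j ≫ ρ i = b i j ≫ ρ j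

/-- The stack associated with a manifold `X`: its objects over `S` are the holomorphic maps
from `S` to `X`. -/
def AnMan.stack (X : AnMan) : OverAn := BasedCategory.ofFunctor (Over.forget X)

/-! ## Fibre products, representable morphisms -/

/-- Objects of the fibre product of `F : 𝒜 ⥤ᵇ 𝒳` and `G : ℬ ⥤ᵇ 𝒳`: triples `(A, B, φ)` of objects
`A`, `B` over the same manifold `S` and an isomorphism `φ : F A ≅ G B` over `𝟙 S`. -/
structure FibreProductObj {𝒜 ℬ 𝒳 : OverAn} (F : 𝒜 ⥤ᵇ 𝒳) (G : ℬ ⥤ᵇ 𝒳) : Type 1 where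
  fst : 𝒜.obj
  snd : ℬ.obj
  iso : F.obj fst ≅ G.obj snd
  base_eq : 𝒜.p.obj fst = ℬ.p.obj snd
  isHomLift : 𝒳.p.IsHomLift (𝟙 (𝒜.p.obj fst)) iso.hom

/-- Morphisms of the fibre product: compatible pairs of morphisms over the same morphism
of `An`. -/
@[ext]
structure FibreProductHom {𝒜 ℬ 𝒳 : OverAn} {F : 𝒜 ⥤ᵇ 𝒳} {G : ℬ ⥤ᵇ 𝒳}
    (a b : FibreProductObj F G) : Type where
  fst : a.fst ⟶ b.fst
  snd : a.snd ⟶ b.snd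
  base_eq : 𝒜.p.map fst ≫ eqToHom b.base_eq = eqToHom a.base_eq ≫ ℬ.p.map snd
  w : F.map fst ≫ b.iso.hom = a.iso.hom ≫ G.map snd

instance {𝒜 ℬ 𝒳 : OverAn} (F : 𝒜 ⥤ᵇ 𝒳) (G : ℬ ⥤ᵇ 𝒳) : Category (FibreProductObj F G) where
  Hom := FibreProductHom
  id a := ⟨𝟙 _, 𝟙 _, by simp, by simp⟩
  comp f g := ⟨f.fst ≫ g.fst, f.snd ≫ g.snd,
    by rw [Functor.map_comp, Category.assoc, g.base_eq, ← Category.assoc, f.base_eq,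
      Category.assoc, Functor.map_comp],
    by rw [Functor.map_comp, Category.assoc, g.w, ← Category.assoc, f.w, Category.assoc,
      Functor.map_comp]⟩
  id_comp f := FibreProductHom.ext (Category.id_comp _) (Category.id_comp _)
  comp_id f := FibreProductHom.ext (Category.comp_id _) (Category.comp_id _)
  assoc f g h := FibreProductHom.ext (Category.assoc _ _ _) (Category.assoc _ _ _)

/-- The first projection of the fibre product, as a functor. -/
def fibreProductFst {𝒜 ℬ 𝒳 : OverAn} (F : 𝒜 ⥤ᵇ 𝒳) (G : ℬ ⥤ᵇ 𝒳) :
    FibreProductObj F G ⥤ 𝒜.obj where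
  obj a := a.fst
  map f := f.fst
  map_id _ := rfl
  map_comp _ _ := rfl

/-- The fibre product of two morphisms of prestacks. -/
def fibreProduct {𝒜 ℬ 𝒳 : OverAn} (F : 𝒜 ⥤ᵇ 𝒳) (G : ℬ ⥤ᵇ 𝒳) : OverAn :=
  BasedCategory.ofFunctor (fibreProductFst F G ⋙ 𝒜.p)

/-- The first projection of the fibre product. -/
def fibreProduct.fst {𝒜 ℬ 𝒳 : OverAn} (F : 𝒜 ⥤ᵇ 𝒳) (G : ℬ ⥤ᵇ 𝒳) : fibreProduct F G ⥤ᵇ 𝒜 where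
  toFunctor := fibreProductFst F G
  w := rfl

/-- The morphism of manifolds corresponding to a morphism between the associated stacks: the image
of the identity of `M`. (Its source is equal to `M`.) -/
def inducedMap {M S : AnMan} (Φ : M.stack ⥤ᵇ S.stack) :=
  (Φ.obj (Over.mk (𝟙 M)) : Over S).hom

/-- The morphism `F : 𝒴 ⥤ᵇ 𝒳` is representable, and the morphisms of manifolds obtained from it by
base change satisfy `P`: for each `S ⟶ 𝒳` there are a manifold `M` and an equivalence between `M`
and `S ×_𝒳 𝒴` such that the induced morphism of manifolds `M ⟶ S` satisfies `P`. -/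
def IsRepresentableWith (P : ∀ ⦃X Y : AnMan⦄, (X ⟶ Y) → Prop) {𝒴 𝒳 : OverAn} (F : 𝒴 ⥤ᵇ 𝒳) : Prop :=
  ∀ (S : AnMan) (x : S.stack ⥤ᵇ 𝒳), ∃ (M : AnMan) (Φ : M.stack ⥤ᵇ fibreProduct x F),
    Φ.toFunctor.IsEquivalence ∧ P (inducedMap (Φ.comp (fibreProduct.fst x F)))

/-- Representable morphisms. -/
def IsRepresentable {𝒴 𝒳 : OverAn} (F : 𝒴 ⥤ᵇ 𝒳) : Prop :=
  IsRepresentableWith (fun _ _ _ => True) F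

/-- Surjective morphisms: every object of `𝒳` is locally in the essential image of `F` (the
morphism `r` exhibits `F B` as a restriction of `A` to `U i`). -/
def IsSurjectiveMorphism {𝒴 : BasedCategory.{v, 1} AnMan} {𝒳 : OverAn} (F : 𝒴 ⥤ᵇ 𝒳) : Prop :=
  ∀ A : 𝒳.obj, ∃ (ι : Type) (U : ι → Opens (𝒳.p.obj A)), ⨆ i, U i = ⊤ ∧
    ∀ i, ∃ (B : 𝒴.obj) (r : F.obj B ⟶ A), 𝒳.p.IsHomLift ((𝒳.p.obj A).incl (U i)) r

/-- The disjoint union of a family of prestacks. -/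
def sigmaStack {ι : Type} (𝒴 : ι → OverAn) : BasedCategory.{1, 1} AnMan :=
  BasedCategory.ofFunctor (𝒳 := Σ i, (𝒴 i).obj) (Sigma.desc fun i => (𝒴 i).p)

/-- The morphism from the disjoint union defined by a family of morphisms. -/
def sigmaDesc {ι : Type} {𝒴 : ι → OverAn} {𝒳 : OverAn} (F : ∀ i, 𝒴 i ⥤ᵇ 𝒳) :
    sigmaStack 𝒴 ⥤ᵇ 𝒳 where
  toFunctor := Sigma.desc fun i => (F i).toFunctor
  w := by
    refine CategoryTheory.Functor.ext (fun ⟨i, a⟩ => (F i).w_obj a) ?_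
    rintro ⟨i, a⟩ ⟨_, b⟩ ⟨f⟩
    exact Functor.congr_hom (F i).w f

/-! ## Analytic stacks and open substacks -/

/-- `𝒳`, equipped with `p : X ⟶ 𝒳`, is an analytic stack. -/
structure IsAnalyticStack (𝒳 : OverAn) {X : AnMan} (p : X.stack ⥤ᵇ 𝒳) : Prop where
  isStack : IsStack 𝒳
  isRepresentable : IsRepresentable p
  isSurjective : IsSurjectiveMorphism p
  isSubmersion : IsRepresentableWith (fun _ _ f => AnMan.IsSubmersion f) p

/-- `F` makes `𝒴` an open substack of `𝒳`. -/
structure IsOpenSubstack {𝒴 𝒳 : OverAn} (F : 𝒴 ⥤ᵇ 𝒳) : Prop where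
  isStack : IsStack 𝒴
  isRepresentable : IsRepresentable F
  isOpen : IsRepresentableWith (fun _ _ f => AnMan.IsOpenMorphism f) F

/-! ## Quotient stacks by discrete groups -/

/-- A manifold with a right action of the (discrete) group `G` by automorphisms;
`x · g` is `op g • x`. -/
structure GMan (G : Type) [Group G] : Type 1 where
  carrier : AnMan
  [mulAction : MulAction Gᵐᵒᵖ carrier]
  contMDiff_act : ∀ g : G, ContMDiff 𝓘(ℂ, carrier.E) 𝓘(ℂ, carrier.E) ω
    (fun x : carrier => op g • x)

attribute [instance] GMan.mulAction

/-- Equivariance of a map between manifolds with group actions, along a group morphism. -/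
def IsEquivariant {H G : Type} [Group H] [Group G] (φ : H →* G) (P : GMan H) (Q : GMan G)
    (f : P.carrier ⟶ Q.carrier) : Prop :=
  ∀ (h : H) (x : P.carrier), f (op h • x) = op (φ h) • f x

/-- `π : P ⟶ S` is a principal bundle under the discrete group `G`: a surjective local
biholomorphism (so that it has local holomorphic sections `s`, and each of them gives a local
trivialisation `(t, g) ↦ s t · g`), with `G` acting simply transitively on the fibres. -/
structure IsPrincipalBundle {G : Type} [Group G] (P : GMan G) {S : AnMan}
    (π : P.carrier ⟶ S) : Prop where
  surjective : Function.Surjective π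
  isLocalDiffeomorph : IsLocalDiffeomorph 𝓘(ℂ, P.carrier.E) 𝓘(ℂ, S.E) ω π
  fibre : ∀ p q : P.carrier, π p = π q ↔ ∃ g : G, q = op g • p
  free : ∀ (p : P.carrier) (g : G), op g • p = p → g = 1

/-- Objects of the quotient stack `[X/G]`: a principal `G`-bundle `proj : bundle ⟶ base` and a
`G`-equivariant holomorphic map `map : bundle ⟶ X`. -/
structure QuotObj {G : Type} [Group G] (X : GMan G) : Type 1 where
  base : AnMan
  bundle : GMan G
  proj : bundle.carrier ⟶ base
  isPrincipalBundle : IsPrincipalBundle bundle proj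
  map : bundle.carrier ⟶ X.carrier
  map_equivariant : IsEquivariant (MonoidHom.id G) bundle X map

/-- Morphisms of the quotient stack: equivariant bundle maps compatible with the maps to `X`.
(Those over the identity are the isomorphisms of principal bundles; in general they
identify the source with the pullback of the target.) -/
@[ext]
structure QuotHom {G : Type} [Group G] {X : GMan G} (P Q : QuotObj X) : Type where
  base : P.base ⟶ Q.base
  total : P.bundle.carrier ⟶ Q.bundle.carrier
  equivariant : IsEquivariant (MonoidHom.id G) P.bundle Q.bundle total
  proj_comm : total ≫ Q.proj = P.proj ≫ base
  map_comm : total ≫ Q.map = P.map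

instance {G : Type} [Group G] (X : GMan G) : Category (QuotObj X) where
  Hom := QuotHom
  id P := ⟨𝟙 _, 𝟙 _, fun _ _ => rfl, rfl, rfl⟩
  comp f g := ⟨f.base ≫ g.base, f.total ≫ g.total,
    fun h x => by
      have h1 := f.equivariant h x
      have h2 := g.equivariant h (f.total x)
      simp only [AnMan.comp_apply, h1, MonoidHom.id_apply] at h2 ⊢
      exact h2,
    by rw [Category.assoc, g.proj_comm, ← Category.assoc, f.proj_comm, Category.assoc],
    by rw [Category.assoc, g.map_comm, f.map_comm]⟩

/-- The quotient stack `[X/G]`. -/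
def quotientStack {G : Type} [Group G] (X : GMan G) : OverAn :=
  BasedCategory.ofFunctor
    ({ obj := fun P => P.base
       map := fun f => f.base
       map_id := fun _ => rfl
       map_comp := fun _ _ => rfl } : QuotObj X ⥤ AnMan)

/-- An object of `[X/G]`, with its bundle. -/
abbrev toQuotObj {G : Type} [Group G] {X : GMan G} (P : (quotientStack X).obj) : QuotObj X := P

/-- A morphism of `[X/G]`, with its bundle map. -/
abbrev toQuotHom {G : Type} [Group G] {X : GMan G} {P Q : (quotientStack X).obj} (f : P ⟶ Q) :
    QuotHom (toQuotObj P) (toQuotObj Q) := f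

/-- `p : X ⟶ [X/G]` is the canonical morphism, defined by the trivial bundle `X × G` and the
action map `X × G ⟶ X`: the object `p (𝟙 X)` has a section `σ` (equivalently, a trivialisation)
such that the equivariant map to `X` sends `σ x · g` to `x · g`. -/
def IsCanonicalAtlas {G : Type} [Group G] (X : GMan G)
    (p : X.carrier.stack ⥤ᵇ quotientStack X) : Prop :=
  let P := toQuotObj (p.obj (Over.mk (𝟙 X.carrier)))
  ∃ σ : P.base ⟶ P.bundle.carrier, σ ≫ P.proj = 𝟙 P.base ∧
    σ ≫ P.map = eqToHom (p.w_obj (Over.mk (𝟙 X.carrier)))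

/-- `F : [Y/H] ⟶ [X/G]` is the morphism induced by `φ : H →* G` and the `φ`-equivariant map
`f : Y ⟶ X`, that is the extension of structure group sending `(P, u)` to `P ×_H G` with the
induced map to `X`. The bundle `P ×_H G` is the principal `G`-bundle over the same base which
receives an `H`-equivariant map from `P`. -/
def IsExtensionOfStructureGroup {H G : Type} [Group H] [Group G] (φ : H →* G) {Y : GMan H}
    {X : GMan G} (f : Y.carrier ⟶ X.carrier) (F : quotientStack Y ⥤ᵇ quotientStack X) : Prop :=
  ∃ j : ∀ P : (quotientStack Y).obj,
      (toQuotObj P).bundle.carrier ⟶ (toQuotObj (F.obj P)).bundle.carrier,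
    (∀ P, IsEquivariant φ (toQuotObj P).bundle (toQuotObj (F.obj P)).bundle (j P)) ∧
    (∀ P, j P ≫ (toQuotObj (F.obj P)).proj ≫ eqToHom (F.w_obj P) = (toQuotObj P).proj) ∧
    (∀ P, j P ≫ (toQuotObj (F.obj P)).map = (toQuotObj P).map ≫ f) ∧
    (∀ (P Q : (quotientStack Y).obj) (m : P ⟶ Q),
      j P ≫ (toQuotHom (F.map m)).total = (toQuotHom m).total ≫ j Q)

/-! ## Analytic orbifolds -/

/-- The stack `𝒳`, equipped with the presentation `p` and the family of morphisms
`F i : [U i / Γ i] ⟶ 𝒳`, is an analytic orbifold. -/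
structure IsAnalyticOrbifold (𝒳 : OverAn) {X : AnMan} (p : X.stack ⥤ᵇ 𝒳) {ι : Type}
    {Γ : ι → Type} [∀ i, Group (Γ i)] (U : ∀ i, GMan (Γ i))
    (F : ∀ i, quotientStack (U i) ⥤ᵇ 𝒳) : Prop where
  isAnalyticStack : IsAnalyticStack 𝒳 p
  finite : ∀ i, Finite (Γ i)
  isOpenSubstack : ∀ i, IsOpenSubstack (F i)
  isSurjective : IsSurjectiveMorphism (sigmaDesc F)

/-! ## Slices -/

namespace GMan

variable {G : Type} [Group G] (X : GMan G)

/-- The stabiliser `G_x` of a point. -/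
def stabiliser (x : X.carrier) : Subgroup G := (MulAction.stabilizer Gᵐᵒᵖ x).unop

/-- An open subset which is invariant under a subgroup `H`, as a manifold with an action of `H`. -/
def restrict (H : Subgroup G) (U : Opens X.carrier)
    (hU : ∀ g ∈ H, ∀ x ∈ U, op g • x ∈ U) : GMan H where
  carrier := X.carrier.restrict U
  mulAction :=
    { smul := fun g x => (⟨op (g.unop : G) • x.1, hU _ g.unop.2 _ x.2⟩ : U)
      one_smul := fun x => Subtype.ext (one_smul Gᵐᵒᵖ x.1)
      mul_smul := fun g h x =>
        Subtype.ext (mul_smul (op (g.unop : G)) (op (h.unop : G)) x.1) }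
  contMDiff_act g := by
    have h : ContMDiff 𝓘(ℂ, X.carrier.E) 𝓘(ℂ, X.carrier.E) ω
        (fun x : U => op (g : G) • (x : X.carrier)) :=
      (X.contMDiff_act g).comp contMDiff_subtype_val
    have h' : ContMDiff 𝓘(ℂ, X.carrier.E) 𝓘(ℂ, X.carrier.E) ω
        (fun x : U => (⟨op (g : G) • x.1, hU _ g.2 _ x.2⟩ : U)) := fun x =>
      (ChartedSpace.liftPropWithinAt_subtypeVal_comp_iff
        (fun x : U => (⟨op (g : G) • x.1, hU _ g.2 _ x.2⟩ : U)) Set.univ x).1 (h x)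
    exact h'

/-- `U` is an open neighbourhood of `x` which is invariant under `G_x` and disjoint from its
translates by the elements of `G` outside `G_x`. -/
structure IsSlice (x : X.carrier) (U : Opens X.carrier) : Prop where
  mem : x ∈ U
  invariant : ∀ g ∈ X.stabiliser x, ∀ y ∈ U, op g • y ∈ U
  disjoint : ∀ g ∉ X.stabiliser x, ∀ y ∈ U, op g • y ∉ U

end GMan

/-! ## The upper half-plane -/

/-- The right action of `SL(2, ℝ)` on `ℍ`: `z · (a c; b d) = (a z + b) / (c z + d)`. -/
def rightMoebius (z : ℍ) (g : SL(2, ℝ)) : ℍ := g.transpose • z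

theorem specialLinearGroup_transpose_one : (1 : SL(2, ℝ)).transpose = 1 :=
  Subtype.ext Matrix.transpose_one

theorem specialLinearGroup_transpose_mul (g h : SL(2, ℝ)) :
    (g * h).transpose = h.transpose * g.transpose :=
  Subtype.ext (Matrix.transpose_mul _ _)

theorem rightMoebius_one (z : ℍ) : rightMoebius z 1 = z := by
  rw [rightMoebius, specialLinearGroup_transpose_one, one_smul]

theorem rightMoebius_mul (z : ℍ) (g h : SL(2, ℝ)) :
    rightMoebius z (g * h) = rightMoebius (rightMoebius z g) h := by
  rw [rightMoebius, specialLinearGroup_transpose_mul, mul_smul]; rfl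

theorem contMDiff_rightMoebius (g : SL(2, ℝ)) :
    ContMDiff 𝓘(ℂ) 𝓘(ℂ) ω (fun z : ℍ => rightMoebius z g) := by
  exact UpperHalfPlane.contMDiff_smul (g := (g.transpose : GL (Fin 2) ℝ)) (by simp)

/-- The inclusion of `SL(2, ℤ)` in `SL(2, ℝ)`. -/
def modularInclusion : SL(2, ℤ) →* SL(2, ℝ) :=
  Matrix.SpecialLinearGroup.map (Int.castRingHom ℝ)

/-- `ℍ` as an analytic manifold. -/
def upperHalfPlane : AnMan where
  carrier := ℍ
  E := ℂ

/-- `ℍ` with the right action of `SL(2, ℤ)`. -/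
def modularAction : GMan SL(2, ℤ) where
  carrier := upperHalfPlane
  mulAction :=
    { smul := fun g (z : ℍ) => rightMoebius z (modularInclusion g.unop)
      one_smul := fun (z : ℍ) => by
        change rightMoebius z (modularInclusion 1) = z
        rw [map_one, rightMoebius_one]
      mul_smul := fun g h (z : ℍ) => by
        change rightMoebius z (modularInclusion (h.unop * g.unop)) =
          rightMoebius (rightMoebius z (modularInclusion h.unop)) (modularInclusion g.unop)
        rw [map_mul, rightMoebius_mul] }
  contMDiff_act g := contMDiff_rightMoebius (modularInclusion g)

/-- `SO(2)` as a subgroup of `SL(2, ℝ)`. -/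
def SO2 : Subgroup SL(2, ℝ) where
  carrier := {g | g * g.transpose = 1}
  one_mem' := by
    change (1 : SL(2, ℝ)) * (1 : SL(2, ℝ)).transpose = 1
    rw [specialLinearGroup_transpose_one, one_mul]
  mul_mem' {a b} ha hb := by
    change a * a.transpose = 1 at ha
    change b * b.transpose = 1 at hb
    change a * b * (a * b).transpose = 1
    rw [specialLinearGroup_transpose_mul, mul_assoc, ← mul_assoc b, hb, one_mul, ha]
  inv_mem' {a} ha := by
    change a * a.transpose = 1 at ha
    change a⁻¹ * a⁻¹.transpose = 1
    have h := specialLinearGroup_transpose_mul a⁻¹ a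
    rw [inv_mul_cancel, specialLinearGroup_transpose_one, eq_inv_of_mul_eq_one_right ha] at h
    rw [inv_mul_eq_one, ← one_mul a⁻¹.transpose, ← mul_inv_cancel a, mul_assoc, ← h, mul_one]

end

/-! The stack statements are formal consequences of one geometric fact, that every map attached to a
principal bundle under a discrete group is étale (a local biholomorphism); the arithmetic enters
only through properness of the action.

Representability is reduced to universal arrows by `isRepresentableWith_of_universal`. A morphism
from `S` to `𝒳` amounts to an object `Q` of `𝒳` over `S`, and a terminal object of the fibre product
of `S` with `F` is an arrow `F B ⟶ Q` through which all such arrows factor uniquely. A category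
fibred in groupoids with a terminal object is equivalent to the manifold underlying that object. For
the canonical atlas, `B` is the total space of `Q` with its map to `X`, because a bundle map out of
a trivial bundle is determined by its values on the section; the induced map is the bundle
projection, an étale map. For a slice `U` with group `H`, `B` is the part of the total space of `Q`
lying over `U`. It is a principal `H`-bundle over an open subset of the base precisely because
translates of `U` by elements outside `H` miss `U`; the induced map is an open inclusion. Every
point of the total space maps to some point `x`, hence into the slice at `x`, so these open subsets
cover the base.

That `[X/G]` is a stack (`quotientStack_isStack`) rests on bundle maps being cartesian. Morphisms
are glued on the étale cover of the total space by its restrictions, and bundles are glued by taking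
the quotient of the disjoint union of the local total spaces. Freeness of the action makes the
quotient Hausdorff, and countability of `G` makes it second countable.

The bundle `P ×_H G` is realised as `P × (H \ G)` with an action twisted by a cocycle of coset
representatives; the trivial subgroup yields the canonical atlas.

For the modular group, properness comes from discreteness in `SL(2, ℝ)`, and it gives finite
stabilisers and slices by shrinking a compact neighbourhood. The homogeneous space statement uses
that `SO2` is the stabiliser of `i` and that the orbit map has a continuous section. -/

noncomputable section

open scoped CategoryTheory.BasedFunctor

/-! ## Étale morphisms of manifolds -/

namespace AnMan

variable {X Y Z : AnMan}

/-- A map between manifolds is holomorphic at a point. -/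
abbrev HolAt (f : X → Y) (x : X) : Prop := ContMDiffAt 𝓘(ℂ, X.E) 𝓘(ℂ, Y.E) ω f x

/-- A map between manifolds is locally biholomorphic at a point. -/
abbrev EtaleAt (f : X → Y) (x : X) : Prop := IsLocalDiffeomorphAt 𝓘(ℂ, X.E) 𝓘(ℂ, Y.E) ω f x

/-- A local biholomorphism. -/
abbrev IsEtale (f : X → Y) : Prop := IsLocalDiffeomorph 𝓘(ℂ, X.E) 𝓘(ℂ, Y.E) ω f

theorem Hom.continuous (f : X ⟶ Y) : Continuous f := f.contMDiff.continuous

open Filter Topology in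
theorem EtaleAt.congr {f g : X → Y} {x : X} (hf : EtaleAt f x) (h : f =ᶠ[𝓝 x] g) :
    EtaleAt g x := by
  obtain ⟨Φ, hx, hΦ⟩ := hf
  obtain ⟨W, hW, hWo, hxW⟩ := eventually_nhds_iff.1 h
  have hs : IsOpen (Φ.source ∩ W) := Φ.open_source.inter hWo
  let e := Φ.toOpenPartialHomeomorph.restrOpen W hWo
  refine ⟨⟨e.toPartialEquiv, e.open_source, e.open_target, ?_, ?_⟩, ⟨hx, hxW⟩, ?_⟩
  · exact Φ.contMDiffOn_toFun.mono Set.inter_subset_left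
  · refine Φ.contMDiffOn_invFun.mono ?_
    exact Set.inter_subset_left
  · rintro y ⟨hy, hyW⟩
    rw [← hW y hyW]
    exact hΦ hy

open Filter Topology in
/-- Uniqueness of local lifts through an étale map. -/
theorem EtaleAt.eventuallyEq_of_comp {W : Type*} [TopologicalSpace W] {π : X → Y} {h k : W → X}
    {a : W} (hπ : EtaleAt π (h a)) (hh : ContinuousAt h a) (hk : ContinuousAt k a)
    (ha : h a = k a) (hc : ∀ᶠ w in 𝓝 a, π (h w) = π (k w)) : h =ᶠ[𝓝 a] k := by
  have h1 := hh.eventually hπ.localInverse_eventuallyEq_left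
  have h2 := hk.eventually (by rw [← ha]; exact hπ.localInverse_eventuallyEq_left)
  filter_upwards [h1, h2, hc] with w h1 h2 h3
  simp only [Function.comp_apply, id_eq] at h1 h2
  rw [← h1, ← h2, h3]

open Filter Topology in
/-- Near `a`, a continuous map `h` is the composite of `π ∘ h` with the local inverse of `π`. -/
theorem EtaleAt.eventuallyEq_localInverse {W : Type*} [TopologicalSpace W] {π : X → Y} {h : W → X}
    {a : W} (hπ : EtaleAt π (h a)) (hh : ContinuousAt h a) :
    hπ.localInverse ∘ π ∘ h =ᶠ[𝓝 a] h :=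
  hh.eventually hπ.localInverse_eventuallyEq_left

/-- Near `a`, `h` is a local inverse of `π` applied to `π ∘ h`. Consequently maps into a bundle need
only be shown continuous with holomorphic projection. -/
theorem EtaleAt.holAt_of_comp_left {π : Y → Z} {h : X → Y} {a : X} (hπ : EtaleAt π (h a))
    (hh : ContinuousAt h a) (hc : HolAt (π ∘ h) a) : HolAt h a :=
  ContMDiffAt.congr_of_eventuallyEq
    (ContMDiffAt.comp a (g := hπ.localInverse) hπ.localInverse_contMDiffAt hc)
    (hπ.eventuallyEq_localInverse hh).symm

theorem EtaleAt.of_comp_left {π : Y → Z} {h : X → Y} {a : X} (hπ : EtaleAt π (h a))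
    (hh : ContinuousAt h a) (hc : EtaleAt (π ∘ h) a) : EtaleAt h a :=
  EtaleAt.congr (IsLocalDiffeomorphAt.comp (K := 𝓘(ℂ, Y.E)) (hf := hc)
    (g := hπ.localInverse) (hg := hπ.localInverse_isLocalDiffeomorphAt)) (hπ.eventuallyEq_localInverse hh)

-- Precomposing `f ∘ k` with a local inverse of `k` recovers `f` near `k a`. This lets holomorphy be
-- tested on an étale cover of the source.
open Filter Topology in
theorem EtaleAt.holAt_of_comp_right {k : X → Y} {f : Y → Z} {a : X} (hk : EtaleAt k a)
    (hc : HolAt (f ∘ k) a) : HolAt f (k a) := by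
  have h0 : hk.localInverse (k a) = a := hk.localInverse_left_inv hk.localInverse_mem_target
  refine ContMDiffAt.congr_of_eventuallyEq (f := (f ∘ k) ∘ hk.localInverse)
    (ContMDiffAt.comp (k a) (by rw [h0]; exact hc) hk.localInverse_contMDiffAt) ?_
  filter_upwards [hk.localInverse_eventuallyEq_right] with y hy
  simp only [Function.comp_apply, id_eq] at hy ⊢
  rw [hy]

theorem IsEtale.isSubmersion {f : X ⟶ Y} (hf : IsEtale f) : IsSubmersion f := fun x => by
  rw [← IsLocalDiffeomorphAt.mfderivToContinuousLinearEquiv_coe (hf x) (by simp)]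
  exact ContinuousLinearEquiv.surjective _

theorem IsEtale.comp {f : X → Y} {g : Y → Z} (hg : IsEtale g) (hf : IsEtale f) :
    IsEtale (g ∘ f) := fun x => IsLocalDiffeomorphAt.comp (K := 𝓘(ℂ, Z.E)) (hf := hf x) (hg := hg _)

theorem isEtale_of_iso {f : X ⟶ Y} (g : Y ⟶ X) (h : f ≫ g = 𝟙 X) (h' : g ≫ f = 𝟙 Y) :
    IsEtale f :=
  (⟨⟨f, g, fun x => congrArg (fun k : X ⟶ X => k x) h, fun y => congrArg (fun k : Y ⟶ Y => k y) h'⟩,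
    f.contMDiff, g.contMDiff⟩ : Diffeomorph 𝓘(ℂ, X.E) 𝓘(ℂ, Y.E) X Y ω).isLocalDiffeomorph

theorem holAt_subtypeVal_comp_iff (U : Opens Y) (f : X → U) (x : X) :
    HolAt (Y := Y) (Subtype.val ∘ f) x ↔ HolAt (Y := Y.restrict U) f x :=
  ChartedSpace.liftPropWithinAt_subtypeVal_comp_iff f Set.univ x

theorem isEtale_incl (U : Opens X) : IsEtale (X.incl U) := by
  intro x
  have : Nonempty U := ⟨x⟩
  let e := U.openPartialHomeomorphSubtypeCoe ⟨x⟩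
  refine ⟨⟨e.toPartialEquiv, e.open_source, e.open_target, ?_, ?_⟩, ?_, ?_⟩
  · exact (X.incl U).contMDiff.contMDiffOn
  · intro y hy
    refine ContMDiffAt.contMDiffWithinAt ?_
    refine (holAt_subtypeVal_comp_iff U e.symm y).1 ?_
    refine ContMDiffAt.congr_of_eventuallyEq (f := id) contMDiffAt_id ?_
    filter_upwards [e.open_target.mem_nhds hy] with z hz
    exact e.right_inv hz
  · exact Set.mem_univ x
  · intro y _; rfl

/-- The map into an open submanifold defined by a map with values in the open subset. -/
def liftOpen (f : X ⟶ Y) (U : Opens Y) (h : ∀ x, f x ∈ U) : X ⟶ Y.restrict U :=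
  ⟨fun x => ⟨f x, h x⟩, fun x =>
    (holAt_subtypeVal_comp_iff U (fun x => ⟨f x, h x⟩) x).1 (f.contMDiff x)⟩

end AnMan

/-! ## The manifold structure of an étale space -/

namespace AnMan

section EtaleSpace

variable (S : AnMan) (P : Type) [TopologicalSpace P] {π : P → S} (h : IsLocalHomeomorph π)

/-- The charts of a space which is étale over a manifold. -/
abbrev etaleChartedSpace : ChartedSpace S.E P where
  atlas := Set.range fun p => (h p).choose.trans (chartAt S.E (π p))
  chartAt p := (h p).choose.trans (chartAt S.E (π p))
  mem_chart_source p := by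
    refine ⟨(h p).choose_spec.1, ?_⟩
    have h1 : (h p).choose p = π p := (congrFun (h p).choose_spec.2 p).symm
    change (h p).choose p ∈ (chartAt S.E (π p)).source
    rw [h1]
    exact mem_chart_source S.E (π p)
  chart_mem_atlas p := ⟨p, rfl⟩

/-- The local homeomorphisms underlying two charts are both restrictions of `π`, so they cancel in
the transition map, which is thus a restriction of a transition map of `S`. -/
theorem etaleIsManifold : letI := etaleChartedSpace S P h; IsManifold 𝓘(ℂ, S.E) ω P := by
  let := etaleChartedSpace S P h
  refine { compatible := ?_ }
  rintro _ _ ⟨p, rfl⟩ ⟨q, rfl⟩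
  have ha := (h p).choose_spec.2
  have hb := (h q).choose_spec.2
  set a := (h p).choose
  set b := (h q).choose
  set c := chartAt S.E (π p)
  set d := chartAt S.E (π q)
  set e := (a.trans c).symm.trans (b.trans d)
  have key : c.symm.trans d ∈ contDiffGroupoid ω 𝓘(ℂ, S.E) :=
    StructureGroupoid.compatible _ (chart_mem_atlas _ _) (chart_mem_atlas _ _)
  have hval : ∀ x ∈ e.source, x ∈ c.target ∧ b (a.symm (c.symm x)) = c.symm x ∧
      b (a.symm (c.symm x)) ∈ d.source := by
    rintro x ⟨⟨h1, h2⟩, ⟨h3, h4⟩⟩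
    refine ⟨h1, ?_, h4⟩
    rw [← hb, ha]
    exact a.right_inv h2
  refine StructureGroupoid.mem_of_eqOnSource _
    (closedUnderRestriction' key e.open_source) ⟨?_, ?_⟩
  · rw [OpenPartialHomeomorph.restr_source' _ _ e.open_source]
    refine (Set.inter_eq_right.2 ?_).symm
    intro x hx
    obtain ⟨h1, h2, h3⟩ := hval x hx
    exact ⟨h1, by rw [h2] at h3; exact h3⟩
  · intro x hx
    change d (b (a.symm (c.symm x))) = d (c.symm x)
    rw [(hval x hx).2.1]

/-- A Hausdorff and second countable space which is étale over a manifold, as a manifold. -/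
def etaleSpace [T2Space P] [SecondCountableTopology P] : AnMan :=
  letI := etaleChartedSpace S P h
  haveI := etaleIsManifold S P h
  { carrier := P
    E := S.E }

end EtaleSpace

theorem etaleAt_chartAt (X : AnMan) (x : X) :
    IsLocalDiffeomorphAt 𝓘(ℂ, X.E) 𝓘(ℂ, X.E) ω (chartAt X.E x) x :=
  ⟨⟨(chartAt X.E x).toPartialEquiv, (chartAt X.E x).open_source, (chartAt X.E x).open_target,
    contMDiffOn_chart, contMDiffOn_chart_symm⟩, mem_chart_source _ _, fun _ _ => rfl⟩

theorem etaleAt_chartAt_symm (X : AnMan) (x : X) :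
    IsLocalDiffeomorphAt 𝓘(ℂ, X.E) 𝓘(ℂ, X.E) ω (chartAt X.E x).symm (chartAt X.E x x) :=
  ⟨⟨(chartAt X.E x).symm.toPartialEquiv, (chartAt X.E x).open_target, (chartAt X.E x).open_source,
    contMDiffOn_chart_symm, contMDiffOn_chart⟩, mem_chart_target _ _, fun _ _ => rfl⟩

-- A chart of the étale space is `π` followed by a chart of `S`; undoing the latter exhibits `π`
-- locally as a composite of two étale maps.
open Filter Topology in
theorem isEtale_etaleSpace (S : AnMan) (P : Type) [TopologicalSpace P] [T2Space P]
    [SecondCountableTopology P] {π : P → S} (h : IsLocalHomeomorph π) :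
    IsEtale (X := etaleSpace S P h) (Y := S) π := by
  intro p
  have ha := (h p).choose_spec.2
  have h1 := etaleAt_chartAt (etaleSpace S P h) p
  have h2 : IsLocalDiffeomorphAt 𝓘(ℂ, S.E) 𝓘(ℂ, S.E) ω (chartAt S.E (π p)).symm
      (chartAt (etaleSpace S P h).E p p) := by
    have : chartAt (etaleSpace S P h).E p p = chartAt S.E (π p) (π p) := by
      exact congrArg (chartAt S.E (π p)) (congrFun ha p).symm
    rw [this]
    exact etaleAt_chartAt_symm S (π p)
  refine EtaleAt.congr (IsLocalDiffeomorphAt.comp (hf := h1) (hg := h2)) ?_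
  filter_upwards [(chartAt (etaleSpace S P h).E p).open_source.mem_nhds (mem_chart_source _ _)]
    with q hq
  have h3 : (h p).choose q = π q := (congrFun ha q).symm
  have h4 := (chartAt S.E (π p)).left_inv (x := (h p).choose q) hq.2
  change (chartAt S.E (π p)).symm (chartAt S.E (π p) ((h p).choose q)) = π q
  rw [h4, h3]

/-- The structural morphism of an étale space. -/
def etaleProj (S : AnMan) (P : Type) [TopologicalSpace P] [T2Space P]
    [SecondCountableTopology P] {π : P → S} (h : IsLocalHomeomorph π) : etaleSpace S P h ⟶ S :=
  ⟨π, (isEtale_etaleSpace S P h).contMDiff⟩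

/-- Holomorphy of continuous maps can be tested after composition with étale maps. -/
theorem IsEtale.contMDiff_of_comp_left {X Y Z : AnMan} {π : Y → Z} (hπ : IsEtale π) {f : X → Y}
    (hf : Continuous f) (hc : ContMDiff 𝓘(ℂ, X.E) 𝓘(ℂ, Z.E) ω (π ∘ f)) :
    ContMDiff 𝓘(ℂ, X.E) 𝓘(ℂ, Y.E) ω f := fun x =>
  EtaleAt.holAt_of_comp_left (hπ (f x)) hf.continuousAt (hc x)

theorem IsEtale.contMDiff_of_comp_eq {X Y Z : AnMan} {π : Y → Z} (hπ : IsEtale π) {f : X → Y}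
    (hf : Continuous f) (k : X ⟶ Z) (hk : ∀ x, π (f x) = k x) :
    ContMDiff 𝓘(ℂ, X.E) 𝓘(ℂ, Y.E) ω f := by
  refine hπ.contMDiff_of_comp_left hf ?_
  rw [show π ∘ f = k from funext hk]
  exact k.contMDiff

end AnMan

/-! ## Fibred categories and representability -/

-- The unique factorisation axiom is strong cartesianness of every morphism, which gives access to
-- the uniqueness of pullbacks up to isomorphism.
open Functor in
theorem IsFibredInGroupoids.isStronglyCartesian {𝒳 : OverAn} (h𝒳 : IsFibredInGroupoids 𝒳)
    {T S : AnMan} (f : T ⟶ S) {A B : 𝒳.obj} (r : B ⟶ A) [𝒳.p.IsHomLift f r] :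
    𝒳.p.IsStronglyCartesian f r where
  universal_property' {C} g s hs := by
    subst_hom_lift 𝒳.p f r
    have := IsHomLift.eq_of_isHomLift 𝒳.p (g ≫ 𝒳.p.map r) s
    obtain ⟨t, ⟨h1, h2⟩, h3⟩ := h𝒳.existsUnique_lift r s g this
    refine ⟨t, ⟨h1 ▸ IsHomLift.map 𝒳.p t, h2⟩, fun t' ht' => h3 t' ⟨?_, ht'.2⟩⟩
    have := ht'.1
    exact (IsHomLift.eq_of_isHomLift 𝒳.p g t').symm

theorem IsFibredInGroupoids.exists_isHomLift {𝒳 : OverAn} (h𝒳 : IsFibredInGroupoids 𝒳)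
    {T S : AnMan} (f : T ⟶ S) (A : 𝒳.obj) (hA : 𝒳.p.obj A = S) :
    ∃ (B : 𝒳.obj) (r : B ⟶ A), 𝒳.p.IsHomLift f r := by
  subst hA
  exact h𝒳.exists_pullback A f

open Functor in
/-- Two pullbacks along the same morphism are isomorphic. -/
theorem IsFibredInGroupoids.exists_iso {𝒳 : OverAn} (h𝒳 : IsFibredInGroupoids 𝒳)
    {T S : AnMan} (f : T ⟶ S) {A B C : 𝒳.obj} (r : B ⟶ A) (s : C ⟶ A)
    (hr : 𝒳.p.IsHomLift f r) (hs : 𝒳.p.IsHomLift f s) :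
    ∃ e : B ≅ C, 𝒳.p.IsHomLift (𝟙 T) e.hom ∧ e.hom ≫ s = r := by
  have := h𝒳.isStronglyCartesian f r
  have := h𝒳.isStronglyCartesian f s
  exact ⟨IsCartesian.domainUniqueUpToIso 𝒳.p f s r, inferInstance, by simp⟩

theorem AnMan.stack_isFibredInGroupoids (M : AnMan) : IsFibredInGroupoids M.stack where
  exists_pullback (A : Over M) T f := by
    refine ⟨(Over.mk (f ≫ A.hom) : Over M), (Over.homMk f : Over.mk (f ≫ A.hom) ⟶ A), ?_⟩
    exact CategoryTheory.IsHomLift.map (Over.forget M) (Over.homMk f : Over.mk (f ≫ A.hom) ⟶ A)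
  existsUnique_lift {A B C : Over M} (r : B ⟶ A) (s : C ⟶ A) (h : C.left ⟶ B.left) hc := by
    change h ≫ r.left = s.left at hc
    refine ⟨(Over.homMk h (by rw [← Over.w r, ← Over.w s, ← hc, Category.assoc]) : C ⟶ B),
      ⟨rfl, ?_⟩, ?_⟩
    · exact Over.OverMorphism.ext hc
    · rintro (t : C ⟶ B) ⟨ht, -⟩
      exact Over.OverMorphism.ext ht

section

variable {𝒜 ℬ 𝒳 : OverAn} {F : 𝒜 ⥤ᵇ 𝒳} {G : ℬ ⥤ᵇ 𝒳}

-- Pullbacks and factorisations are formed separately in `𝒜` and `ℬ`; the comparison isomorphism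
-- over the new base, and the compatibility of the factorisations with it, come from cartesian
-- arrows in `𝒳`.
open Functor in
theorem fibreProduct_isFibredInGroupoids (h𝒜 : IsFibredInGroupoids 𝒜)
    (hℬ : IsFibredInGroupoids ℬ) (h𝒳 : IsFibredInGroupoids 𝒳) :
    IsFibredInGroupoids (fibreProduct F G) where
  exists_pullback (a : FibreProductObj F G) T f := by
    change T ⟶ 𝒜.p.obj a.fst at f
    obtain ⟨A, r, hr⟩ := h𝒜.exists_pullback a.fst f
    obtain ⟨B, s, hs⟩ := hℬ.exists_isHomLift f a.snd a.base_eq.symm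
    obtain rfl := IsHomLift.domain_eq 𝒜.p f r
    have hB := IsHomLift.domain_eq ℬ.p f s
    have := a.isHomLift
    obtain ⟨e, he, hes⟩ := h𝒳.exists_iso f (F.map r ≫ a.iso.hom) (G.map s) inferInstance
      inferInstance
    refine ⟨(⟨A, B, e, hB.symm, he⟩ : FibreProductObj F G), ⟨r, s, ?_, hes.symm⟩, ?_⟩
    · rw [IsHomLift.fac' 𝒜.p f r, IsHomLift.fac' ℬ.p f s]
      simp
    · have h1 := IsHomLift.eq_of_isHomLift 𝒜.p f r
      subst h1
      exact Functor.IsHomLift.map (p := (fibreProduct F G).p)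
        (a := (⟨A, B, e, hB.symm, he⟩ : FibreProductObj F G)) (b := a) ⟨r, s, _, _⟩
  existsUnique_lift {a b c : FibreProductObj F G} (r : FibreProductHom b a)
      (s : FibreProductHom c a) (h : 𝒜.p.obj c.fst ⟶ 𝒜.p.obj b.fst) hc := by
    change h ≫ 𝒜.p.map r.fst = 𝒜.p.map s.fst at hc
    obtain ⟨t, ⟨ht, htr⟩, hu⟩ := h𝒜.existsUnique_lift r.fst s.fst h hc
    obtain ⟨t', ⟨ht', htr'⟩, hu'⟩ := hℬ.existsUnique_lift r.snd s.snd
      (eqToHom c.base_eq.symm ≫ h ≫ eqToHom b.base_eq) (by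
        have h1 := r.base_eq
        have h2 := s.base_eq
        rw [← cancel_epi (eqToHom c.base_eq)]
        rw [← h2, ← hc]
        simp [h1])
    have hb := b.isHomLift
    have hc' := c.isHomLift
    have l1 : 𝒜.p.IsHomLift h t := ht ▸ IsHomLift.map 𝒜.p t
    have l2 : ℬ.p.IsHomLift h t' :=
      IsHomLift.of_fac' _ _ _ c.base_eq.symm b.base_eq.symm ht'
    have := h𝒳.isStronglyCartesian (ℬ.p.map r.snd) (G.map r.snd)
    have l3 : 𝒳.p.IsHomLift (h ≫ eqToHom b.base_eq) (F.map t ≫ b.iso.hom) := inferInstance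
    have l4 : 𝒳.p.IsHomLift (h ≫ eqToHom b.base_eq) (c.iso.hom ≫ G.map t') := inferInstance
    refine ⟨(⟨t, t', by rw [ht, ht']; simp, ?_⟩ : FibreProductHom c b), ⟨ht, ?_⟩, ?_⟩
    · refine IsStronglyCartesian.ext 𝒳.p (ℬ.p.map r.snd) (G.map r.snd) (h ≫ eqToHom b.base_eq) ?_
      simp only [Category.assoc]
      rw [← r.w, ← G.map_comp, htr', ← s.w, ← htr, F.map_comp, Category.assoc]
    · exact FibreProductHom.ext htr htr'
    · rintro (k : FibreProductHom c b) ⟨hk, hk'⟩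
      change 𝒜.p.map k.fst = h at hk
      refine FibreProductHom.ext (hu _ ⟨hk, congrArg FibreProductHom.fst hk'⟩)
        (hu' _ ⟨?_, congrArg FibreProductHom.snd hk'⟩)
      rw [← hk, ← cancel_epi (eqToHom c.base_eq), ← k.base_eq]
      simp

end

/-! ### Categories fibred in groupoids with a terminal object -/

section

variable {𝒵 : OverAn} (h𝒵 : IsFibredInGroupoids 𝒵) (ξ : 𝒵.obj)

/-- The pullback of `ξ` along `f`. -/
def IsFibredInGroupoids.pullbackObj (f : Over (𝒵.p.obj ξ)) : 𝒵.obj :=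
  (h𝒵.exists_pullback ξ f.hom).choose

/-- The morphism from the pullback of `ξ` to `ξ`. -/
def IsFibredInGroupoids.pullbackHom (f : Over (𝒵.p.obj ξ)) : h𝒵.pullbackObj ξ f ⟶ ξ :=
  (h𝒵.exists_pullback ξ f.hom).choose_spec.choose

instance isHomLift_pullbackHom (f : Over (𝒵.p.obj ξ)) : 𝒵.p.IsHomLift f.hom (h𝒵.pullbackHom ξ f) :=
  (h𝒵.exists_pullback ξ f.hom).choose_spec.choose_spec

instance (f : Over (𝒵.p.obj ξ)) : 𝒵.p.IsStronglyCartesian f.hom (h𝒵.pullbackHom ξ f) :=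
  h𝒵.isStronglyCartesian _ _

open Functor in
/-- The morphism from a manifold corresponding to an object over it. -/
def IsFibredInGroupoids.classify : (𝒵.p.obj ξ).stack ⥤ᵇ 𝒵 where
  obj f := h𝒵.pullbackObj ξ f
  map {f g : Over (𝒵.p.obj ξ)} (k : f ⟶ g) := IsStronglyCartesian.map 𝒵.p g.hom
    (h𝒵.pullbackHom ξ g) (Over.w k).symm (h𝒵.pullbackHom ξ f)
  map_id (f : Over (𝒵.p.obj ξ)) := by
    exact IsStronglyCartesian.map_self 𝒵.p f.hom (h𝒵.pullbackHom ξ f)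
  map_comp {f g h : Over (𝒵.p.obj ξ)} (k : f ⟶ g) (l : g ⟶ h) := by
    have : 𝒵.p.IsHomLift (k ≫ l).left (IsStronglyCartesian.map 𝒵.p g.hom (h𝒵.pullbackHom ξ g)
        (Over.w k).symm (h𝒵.pullbackHom ξ f) ≫ IsStronglyCartesian.map 𝒵.p h.hom
        (h𝒵.pullbackHom ξ h) (Over.w l).symm (h𝒵.pullbackHom ξ g)) :=
      inferInstanceAs (𝒵.p.IsHomLift (k.left ≫ l.left) _)
    refine (IsStronglyCartesian.map_uniq 𝒵.p h.hom (h𝒵.pullbackHom ξ h)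
      (g := (k ≫ l).left) (Over.w (k ≫ l)).symm _ _ ?_).symm
    rw [Category.assoc, IsStronglyCartesian.fac, IsStronglyCartesian.fac]
  w := by
    refine CategoryTheory.Functor.ext
      (fun f : Over (𝒵.p.obj ξ) => @IsHomLift.domain_eq _ _ _ _ 𝒵.p _ _ _ _ f.hom
        (h𝒵.pullbackHom ξ f) (isHomLift_pullbackHom h𝒵 ξ f)) ?_
    intro (f : Over (𝒵.p.obj ξ)) (g : Over (𝒵.p.obj ξ)) (k : f ⟶ g)
    exact IsHomLift.fac' 𝒵.p k.left (IsStronglyCartesian.map 𝒵.p g.hom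
      (h𝒵.pullbackHom ξ g) (Over.w k).symm (h𝒵.pullbackHom ξ f))

open Functor in
/-- A category fibred in groupoids with a terminal object is equivalent to a manifold. -/
theorem IsFibredInGroupoids.classify_isEquivalence (hξ : ∀ z, Nonempty (Unique (z ⟶ ξ))) :
    (h𝒵.classify ξ).toFunctor.IsEquivalence := by
  have ext : ∀ {z} (a b : z ⟶ ξ), a = b := fun {z} a b =>
    have := (hξ z).some
    Subsingleton.elim a b
  refine { faithful := ⟨?_⟩, full := ⟨?_⟩, essSurj := ⟨?_⟩ }
  · intro (f : Over (𝒵.p.obj ξ)) (g : Over (𝒵.p.obj ξ)) (k : f ⟶ g) (l : f ⟶ g) hkl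
    refine Over.OverMorphism.ext ?_
    rw [IsHomLift.fac 𝒵.p k.left (IsStronglyCartesian.map 𝒵.p g.hom
      (h𝒵.pullbackHom ξ g) (Over.w k).symm (h𝒵.pullbackHom ξ f)),
      IsHomLift.fac 𝒵.p l.left (IsStronglyCartesian.map 𝒵.p g.hom
      (h𝒵.pullbackHom ξ g) (Over.w l).symm (h𝒵.pullbackHom ξ f))]
    congr 2
    exact congrArg 𝒵.p.map hkl
  · intro (f : Over (𝒵.p.obj ξ)) (g : Over (𝒵.p.obj ξ))
      (t : h𝒵.pullbackObj ξ f ⟶ h𝒵.pullbackObj ξ g)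
    have h1 : t ≫ h𝒵.pullbackHom ξ g = h𝒵.pullbackHom ξ f := ext _ _
    have hf := IsHomLift.domain_eq 𝒵.p f.hom (h𝒵.pullbackHom ξ f)
    have hg := IsHomLift.domain_eq 𝒵.p g.hom (h𝒵.pullbackHom ξ g)
    let k : f ⟶ g := Over.homMk (eqToHom hf.symm ≫ 𝒵.p.map t ≫ eqToHom hg) (by
      rw [IsHomLift.fac 𝒵.p g.hom (h𝒵.pullbackHom ξ g),
        IsHomLift.fac 𝒵.p f.hom (h𝒵.pullbackHom ξ f)]
      simp [← h1])
    refine ⟨k, ?_⟩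
    have : 𝒵.p.IsHomLift k.left t := IsHomLift.of_fac 𝒵.p _ _ hf hg rfl
    exact (IsStronglyCartesian.map_uniq 𝒵.p g.hom (h𝒵.pullbackHom ξ g)
      (g := k.left) (Over.w k).symm _ t h1).symm
  · intro z
    have u : z ⟶ ξ := (hξ z).some.default
    obtain ⟨e, -⟩ := h𝒵.exists_iso (𝒵.p.map u) (h𝒵.pullbackHom ξ (Over.mk (𝒵.p.map u))) u
      (isHomLift_pullbackHom h𝒵 ξ (Over.mk (𝒵.p.map u))) inferInstance
    exact ⟨Over.mk (𝒵.p.map u), ⟨e⟩⟩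

-- Pullbacks being chosen, the pullback of `ξ` along the identity is only isomorphic to `ξ`; this
-- isomorphism is what identifies the induced map of manifolds.
open Functor in
theorem IsFibredInGroupoids.nonempty_classify_id_iso :
    Nonempty ((h𝒵.classify ξ).obj (Over.mk (𝟙 (𝒵.p.obj ξ))) ≅ ξ) := by
  obtain ⟨e, -⟩ := h𝒵.exists_iso (𝟙 (𝒵.p.obj ξ))
    (h𝒵.pullbackHom ξ (Over.mk (𝟙 (𝒵.p.obj ξ)))) (𝟙 ξ)
    (isHomLift_pullbackHom h𝒵 ξ (Over.mk (𝟙 (𝒵.p.obj ξ)))) inferInstance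
  exact ⟨e⟩

end

open Functor in
/-- A morphism for which each object of the target admits a universal arrow is representable. -/
theorem isRepresentableWith_of_universal {P : ∀ ⦃X Y : AnMan⦄, (X ⟶ Y) → Prop}
    (hP : ∀ {X Y X' Y' : AnMan} (f : X ⟶ Y) (e : X' ≅ X) (e' : Y ≅ Y'), P f →
      P (e.hom ≫ f ≫ e'.hom))
    {𝒴 𝒳 : OverAn} (h𝒴 : IsFibredInGroupoids 𝒴) (h𝒳 : IsFibredInGroupoids 𝒳) (F : 𝒴 ⥤ᵇ 𝒳)
    (H : ∀ Q : 𝒳.obj, ∃ (B : 𝒴.obj) (m : F.obj B ⟶ Q),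
      (∀ (B' : 𝒴.obj) (m' : F.obj B' ⟶ Q), ∃! b : B' ⟶ B, F.map b ≫ m = m') ∧
      P (𝒳.p.map m)) : IsRepresentableWith P F := by
  intro S x
  let i : Over S := Over.mk (𝟙 S)
  have toI : ∀ {a : Over S} (k l : a ⟶ i), k = l := fun k l => Over.OverMorphism.ext (by
    have h1 := Over.w k
    have h2 := Over.w l
    simp only [i, Over.mk_hom] at h1 h2
    exact (Category.comp_id _).symm.trans (h1.trans (h2.symm.trans (Category.comp_id _))))
  obtain ⟨B, m, huniv, hm⟩ := H (x.obj i)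
  let f : 𝒴.p.obj B ⟶ S := eqToHom (F.w_obj B).symm ≫ 𝒳.p.map m ≫ eqToHom (x.w_obj i)
  have hfm : 𝒳.p.IsHomLift f m := IsHomLift.of_fac 𝒳.p _ _ (F.w_obj B) (x.w_obj i) rfl
  let α : Over.mk f ⟶ i := Over.homMk f
  have hα : S.stack.p.IsHomLift f α := IsHomLift.map (Over.forget S) α
  have hxα : 𝒳.p.IsHomLift f (x.map α) := x.preserves_isHomLift f α
  have := h𝒳.isStronglyCartesian f m
  obtain ⟨e, hel, he⟩ := h𝒳.exists_iso f (x.map α) m hxα hfm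
  have toX : ∀ {a : Over S} (k : a ⟶ Over.mk f) (l : a ⟶ i), x.map k ≫ x.map α = x.map l :=
    fun k l => (x.toFunctor.map_comp k α).symm.trans (congrArg x.map (toI _ _))
  -- The terminal object of the fibre product: `m` lies over `f`, so its source is identified by `e`
  -- with the pullback of `x.obj i` along `f`.
  let ξ : FibreProductObj x F := ⟨Over.mk f, B, e, rfl, hel⟩
  have h𝒵 : IsFibredInGroupoids (fibreProduct x F) :=
    fibreProduct_isFibredInGroupoids S.stack_isFibredInGroupoids h𝒴 h𝒳
  refine ⟨(fibreProduct x F).p.obj ξ, h𝒵.classify ξ, h𝒵.classify_isEquivalence ξ ?_, ?_⟩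
  · intro (z : FibreProductObj x F)
    let zf : Over S := z.fst
    have hzl : 𝒳.p.IsHomLift (𝟙 (zf.left)) z.iso.hom := z.isHomLift
    have h0 : zf.left = 𝒴.p.obj z.snd := z.base_eq
    let ζ : zf ⟶ i := Over.homMk zf.hom
    have hζ : S.stack.p.IsHomLift zf.hom ζ := IsHomLift.map (Over.forget S) ζ
    have hxζ : 𝒳.p.IsHomLift zf.hom (x.map ζ) := x.preserves_isHomLift zf.hom ζ
    have hzi : 𝒳.p.IsHomLift (𝟙 zf.left) z.iso.inv := IsHomLift.lift_id_inv 𝒳.p zf.left z.iso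
    have hm' : 𝒳.p.IsHomLift zf.hom (z.iso.inv ≫ x.map ζ) :=
      IsHomLift.comp_lift_id_left 𝒳.p zf.hom (x.map ζ) z.iso.inv
    -- An object `z` of the fibre product is turned into an arrow from `F z.snd` to `x.obj i`; the
    -- universal property then produces the second component of the arrow to `ξ`, and its base
    -- determines the first.
    obtain ⟨b, hb, hbu⟩ := huniv z.snd (z.iso.inv ≫ x.map ζ)
    have hFb : 𝒳.p.IsHomLift (𝒴.p.map b) (F.map b) := inferInstance
    have hbase : (eqToHom h0 ≫ 𝒴.p.map b) ≫ f = zf.hom := by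
      have h1 : 𝒳.p.IsHomLift ((eqToHom h0 ≫ 𝒴.p.map b) ≫ f) (F.map b ≫ m) := inferInstance
      rw [hb] at h1
      exact (IsHomLift.fac 𝒳.p ((eqToHom h0 ≫ 𝒴.p.map b) ≫ f) (z.iso.inv ≫ x.map ζ)).trans
        (IsHomLift.fac 𝒳.p zf.hom (z.iso.inv ≫ x.map ζ)).symm
    let t : zf ⟶ Over.mk f := Over.homMk (eqToHom h0 ≫ 𝒴.p.map b) hbase
    have ht : S.stack.p.IsHomLift (eqToHom h0 ≫ 𝒴.p.map b) t :=
      IsHomLift.map (Over.forget S) t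
    have hxt : 𝒳.p.IsHomLift (eqToHom h0 ≫ 𝒴.p.map b) (x.map t) :=
      x.preserves_isHomLift _ t
    have hzb : 𝒳.p.IsHomLift (eqToHom h0 ≫ 𝒴.p.map b) (z.iso.hom ≫ F.map b) :=
      IsHomLift.comp_lift_id_left 𝒳.p _ (F.map b) z.iso.hom
    have hte : 𝒳.p.IsHomLift (eqToHom h0 ≫ 𝒴.p.map b) (x.map t ≫ e.hom) :=
      IsHomLift.comp_lift_id_right 𝒳.p _ (x.map t) e.hom
    refine ⟨⟨⟨(⟨t, b, ?_, ?_⟩ : FibreProductHom z ξ)⟩, ?_⟩⟩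
    · exact Category.comp_id _
    · refine IsStronglyCartesian.ext 𝒳.p f m (eqToHom h0 ≫ 𝒴.p.map b) ?_
      rw [Category.assoc, Category.assoc, he, hb]
      exact (toX t ζ).trans (z.iso.hom_inv_id_assoc _).symm
    · rintro (k : FibreProductHom z ξ)
      have hks : k.snd = b := by
        refine hbu _ ?_
        change F.map k.snd ≫ m = _
        rw [Iso.eq_inv_comp, ← Category.assoc, ← k.w, Category.assoc]
        change x.map k.fst ≫ e.hom ≫ m = _
        rw [he]
        exact toX k.fst ζ
      refine FibreProductHom.ext (Over.OverMorphism.ext ?_) hks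
      have := k.base_eq
      rw [hks] at this
      exact (Category.comp_id _).symm.trans this
  -- The induced map agrees with `𝒳.p.map m` only up to isomorphisms of source and target, whence
  -- the invariance hypothesis `hP`.
  · obtain ⟨u⟩ := h𝒵.nonempty_classify_id_iso ξ
    let u' := (fibreProductFst x F).mapIso u
    have h1 := hP (𝒳.p.map m) ((Over.forget S).mapIso u' ≪≫ eqToIso (F.w_obj B).symm)
      (eqToIso (x.w_obj i)) hm
    have h2 := Over.w u'.hom
    have h3 : ((Over.forget S).mapIso u' ≪≫ eqToIso (F.w_obj B).symm).hom ≫ 𝒳.p.map m ≫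
        (eqToIso (x.w_obj i)).hom =
        inducedMap ((h𝒵.classify ξ).comp (fibreProduct.fst x F)) := by
      refine Eq.trans ?_ h2
      simp [ξ, f]
      rfl
    rw [h3] at h1
    exact h1

/-! ## Principal bundles -/

section PrincipalBundles

open AnMan

variable {G : Type} [Group G]

theorem IsPrincipalBundle.isEtale {P : GMan G} {S : AnMan} {π : P.carrier ⟶ S}
    (h : IsPrincipalBundle P π) : IsEtale π := h.isLocalDiffeomorph

theorem IsPrincipalBundle.proj_smul {P : GMan G} {S : AnMan} {π : P.carrier ⟶ S}
    (h : IsPrincipalBundle P π) (g : G) (p : P.carrier) : π (op g • p) = π p :=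
  ((h.fibre p _).2 ⟨g, rfl⟩).symm

theorem IsPrincipalBundle.eq_of_smul_eq {P : GMan G} {S : AnMan} {π : P.carrier ⟶ S}
    (h : IsPrincipalBundle P π) {g g' : G} {p : P.carrier} (hg : op g • p = op g' • p) :
    g = g' := by
  have := h.free p (g * g'⁻¹) (by rw [op_mul, mul_smul, hg, ← mul_smul, ← op_mul]; simp)
  exact mul_inv_eq_one.1 this

/-- The action of an element of the group, as a morphism. -/
def GMan.act (X : GMan G) (g : G) : X.carrier ⟶ X.carrier := ⟨fun x => op g • x, X.contMDiff_act g⟩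

@[simp] theorem GMan.act_apply (X : GMan G) (g : G) (x : X.carrier) : X.act g x = op g • x := rfl

theorem GMan.isEtale_act (X : GMan G) (g : G) : IsEtale (X.act g) :=
  isEtale_of_iso (X.act g⁻¹)
    (AnMan.hom_ext fun x => by simp) (AnMan.hom_ext fun x => by simp)

/-- A map defined on a set of generators of a manifold with group action extends to
an equivariant holomorphic map. -/
theorem GMan.exists_equivariant_extension {E Y : GMan G} {J : AnMan} {j : J → E.carrier}
    (hj : IsEtale j) (hgen : ∀ e, ∃ a, ∃ g : G, e = op g • j a) (h : J ⟶ Y.carrier)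
    (hcompat : ∀ a a' (g : G), j a' = op g • j a → h a' = op g • h a) :
    ∃ m : E.carrier ⟶ Y.carrier, IsEquivariant (MonoidHom.id G) E Y m ∧ ∀ a, m (j a) = h a := by
  choose a g hag using hgen
  -- Independence of the choices: two presentations of one point as a translated generator differ by
  -- a relation in `E` between generators, to which `hcompat` applies.
  have key : ∀ (b : J) (k : G), op (g (op k • j b)) • h (a (op k • j b)) = op k • h b := by
    intro b k
    have h1 := hag (op k • j b)
    have h2 : j (a (op k • j b)) = op (k * (g (op k • j b))⁻¹) • j b := by
      rw [op_mul, mul_smul, MulOpposite.op_inv]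
      exact eq_inv_smul_iff.2 h1.symm
    rw [hcompat _ _ _ h2, ← mul_smul, ← op_mul]
    simp
  refine ⟨⟨fun e => op (g e) • h (a e), fun e => ?_⟩, fun k e => ?_, fun b => ?_⟩
  -- With the group element frozen at `g e`, translated generators give an étale map onto a
  -- neighbourhood of `e`, and by `key` the extension composed with it is a translate of `h`.
  · suffices HolAt (fun e => op (g e) • h (a e)) (op (g e) • j (a e)) by rwa [← hag e] at this
    have h1 : EtaleAt (fun b => op (g e) • j b) (a e) :=
      IsLocalDiffeomorphAt.comp (hf := hj (a e)) (hg := E.isEtale_act (g e) (j (a e)))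
    refine EtaleAt.holAt_of_comp_right (k := fun b => op (g e) • j b)
      (f := fun e => op (g e) • h (a e)) h1 ?_
    have h2 : ((fun e => op (g e) • h (a e)) ∘ fun b => op (g e) • j b) =
        fun b => op (g e) • h b := funext fun b => key b (g e)
    rw [h2]
    exact (h ≫ Y.act (g e)).contMDiff _
  · change op (g (op k • e)) • h (a (op k • e)) = op k • op (g e) • h (a e)
    have h1 := key (a e) (g e * k)
    rw [op_mul, mul_smul, ← hag e] at h1
    rw [h1, mul_smul]
  · have h1 := key b 1
    simpa using h1

variable {X : GMan G}

/-! ### Morphisms of principal bundles as cartesian squares -/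

namespace QuotHom

variable {P Q : QuotObj X}

theorem total_smul (r : QuotHom P Q) (g : G) (b : P.bundle.carrier) :
    r.total (op g • b) = op g • r.total b := r.equivariant g b

theorem proj_total (r : QuotHom P Q) (b : P.bundle.carrier) :
    Q.proj (r.total b) = r.base (P.proj b) :=
  congrArg (fun k : P.bundle.carrier ⟶ Q.base => k b) r.proj_comm

theorem map_total (r : QuotHom P Q) (b : P.bundle.carrier) : Q.map (r.total b) = P.map b :=
  congrArg (fun k : P.bundle.carrier ⟶ X.carrier => k b) r.map_comm

theorem ext_total {r s : QuotHom P Q} (h : ∀ b, r.total b = s.total b) : r = s := by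
  refine QuotHom.ext (AnMan.hom_ext fun x => ?_) (AnMan.hom_ext h)
  obtain ⟨b, rfl⟩ := P.isPrincipalBundle.surjective x
  rw [← r.proj_total, ← s.proj_total, h]

/-- A morphism of bundles is injective on each fibre. -/
theorem eq_of_total_eq (r : QuotHom P Q) {b b' : P.bundle.carrier} (h : P.proj b = P.proj b')
    (h' : r.total b = r.total b') : b = b' := by
  obtain ⟨g, rfl⟩ := (P.isPrincipalBundle.fibre b b').1 h
  rw [r.total_smul] at h'
  rw [Q.isPrincipalBundle.free _ _ h'.symm, op_one, one_smul]

/-- A morphism of bundles is surjective on each fibre. -/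
theorem exists_total_eq (r : QuotHom P Q) {x : P.base} {a : Q.bundle.carrier}
    (h : Q.proj a = r.base x) : ∃ b, P.proj b = x ∧ r.total b = a := by
  obtain ⟨b, rfl⟩ := P.isPrincipalBundle.surjective x
  rw [← r.proj_total] at h
  obtain ⟨g, hg⟩ := (Q.isPrincipalBundle.fibre _ _).1 h.symm
  exact ⟨op g • b, P.isPrincipalBundle.proj_smul g b, by rw [r.total_smul, hg]⟩

open Filter Topology in
/-- The total space of the source of a morphism is the fibre product of its base with
the total space of the target. -/
theorem exists_lift (r : QuotHom P Q) {T : AnMan} (h : T ⟶ P.base) (k : T ⟶ Q.bundle.carrier)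
    (hk : ∀ t, Q.proj (k t) = r.base (h t)) :
    ∃ l : T ⟶ P.bundle.carrier, (∀ t, P.proj (l t) = h t) ∧ ∀ t, r.total (l t) = k t := by
  choose l hl hl' using fun t => r.exists_total_eq (hk t)
  -- The lift exists pointwise because `r.total` is bijective on fibres. For holomorphy it is
  -- compared with a local section of `P.proj` through `l t`: the image of this section and `k` are
  -- lifts of the same map through the étale `Q.proj` that agree at `t`, hence agree nearby.
  refine ⟨⟨l, fun t => ?_⟩, hl, hl'⟩
  have hP := P.isPrincipalBundle.isEtale (l t)
  have hQ := Q.isPrincipalBundle.isEtale (k t)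
  have hsec : HolAt hP.localInverse (h t) := by
    rw [← hl t]
    exact hP.localInverse_contMDiffAt
  have h0 : hP.localInverse (h t) = l t := by
    rw [← hl t]
    exact hP.localInverse_left_inv hP.localInverse_mem_target
  have hc : HolAt (hP.localInverse ∘ h) t := ContMDiffAt.comp t hsec (h.contMDiff t)
  refine ContMDiffAt.congr_of_eventuallyEq hc ?_
  have hs : ∀ᶠ t' in 𝓝 t, P.proj (hP.localInverse (h t')) = h t' := by
    have := hP.localInverse_eventuallyEq_right
    rw [hl t] at this
    exact h.continuous.continuousAt.eventually this
  have hr : k =ᶠ[𝓝 t] fun t' => r.total (hP.localInverse (h t')) := by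
    refine EtaleAt.eventuallyEq_of_comp hQ k.continuous.continuousAt ?_ ?_ ?_
    · exact r.total.continuous.continuousAt.comp (ContMDiffAt.continuousAt hc)
    · rw [h0, hl']
    · filter_upwards [hs] with t' ht'
      rw [hk, r.proj_total, ht']
  filter_upwards [hr, hs] with t' h1 h2
  exact r.eq_of_total_eq ((hl t').trans h2.symm) ((hl' t').trans h1)

theorem isEtale_total (r : QuotHom P Q) (h : IsEtale r.base) : IsEtale r.total := fun b =>
  EtaleAt.of_comp_left (Q.isPrincipalBundle.isEtale _) r.total.continuous.continuousAt (by
    have h1 : (Q.proj : Q.bundle.carrier → Q.base) ∘ r.total = r.base ∘ P.proj :=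
      funext r.proj_total
    rw [h1]
    exact h.comp P.isPrincipalBundle.isEtale b)

end QuotHom

/-! ## Bundles from étale spaces -/

/-- An étale space with a continuous group action over the base, as a manifold with
group action. -/
def etaleGMan (S : AnMan) (P : Type) [TopologicalSpace P] [T2Space P]
    [SecondCountableTopology P] [MulAction Gᵐᵒᵖ P] {π : P → S} (h : IsLocalHomeomorph π)
    (hc : ∀ g : G, Continuous fun p : P => op g • p) (hπ : ∀ (g : G) p, π (op g • p) = π p) :
    GMan G where
  carrier := etaleSpace S P h
  mulAction := inferInstanceAs (MulAction Gᵐᵒᵖ P)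
  contMDiff_act g := IsEtale.contMDiff_of_comp_eq (X := etaleSpace S P h) (Y := etaleSpace S P h)
    (isEtale_etaleSpace S P h) (hc g) (etaleProj S P h) (hπ g)

open Filter Topology in
theorem isLocalHomeomorph_of_isOpenMap {P S : Type*} [TopologicalSpace P] [TopologicalSpace S]
    {π : P → S} (hc : Continuous π) (ho : IsOpenMap π)
    (hi : ∀ p, ∃ U : Set P, IsOpen U ∧ p ∈ U ∧ Set.InjOn π U) : IsLocalHomeomorph π := by
  rw [isLocalHomeomorph_iff_isOpenEmbedding_restrict]
  intro p
  obtain ⟨U, hU, hp, hi⟩ := hi p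
  exact ⟨U, hU.mem_nhds hp, .of_continuous_injective_isOpenMap
    (hc.comp continuous_subtype_val) (Set.injOn_iff_injective.1 hi) (ho.domRestrict hU)⟩

/-! ### Pullback of principal bundles -/

section Pullback

variable (A : QuotObj X) {T : AnMan} (f : T ⟶ A.base)

/-- The fibre product of a bundle with a manifold over its base. -/
def PullbackSpace : Type := {x : T × A.bundle.carrier // f x.1 = A.proj x.2}

instance : TopologicalSpace (PullbackSpace A f) :=
  inferInstanceAs (TopologicalSpace {x : T × A.bundle.carrier // f x.1 = A.proj x.2})

instance : T2Space (PullbackSpace A f) :=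
  inferInstanceAs (T2Space {x : T × A.bundle.carrier // f x.1 = A.proj x.2})

instance : SecondCountableTopology (PullbackSpace A f) :=
  inferInstanceAs (SecondCountableTopology ({x | f x.1 = A.proj x.2} : Set (T × A.bundle.carrier)))

instance : MulAction Gᵐᵒᵖ (PullbackSpace A f) where
  smul g x := ⟨(x.1.1, g • x.1.2), x.2.trans (A.isPrincipalBundle.proj_smul g.unop x.1.2).symm⟩
  one_smul _ := Subtype.ext (Prod.ext rfl (one_smul _ _))
  mul_smul g h x := Subtype.ext (Prod.ext rfl (mul_smul g h x.1.2))

/-- Base change of an étale map: openness comes from openness of `A.proj`, and local injectivity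
from a sheet of `A.proj`. -/
theorem PullbackSpace.isLocalHomeomorph :
    IsLocalHomeomorph (fun x : PullbackSpace A f => x.1.1) := by
  have hπ := A.isPrincipalBundle.isLocalDiffeomorph.isLocalHomeomorph
  have hc1 : Continuous fun x : PullbackSpace A f => x.1.1 :=
    continuous_fst.comp continuous_subtype_val
  have hc2 : Continuous fun x : PullbackSpace A f => x.1.2 :=
    continuous_snd.comp continuous_subtype_val
  refine isLocalHomeomorph_of_isOpenMap hc1 ?_ ?_
  · refine IsOpenMap.of_nhds_le fun x N hN => ?_
    obtain ⟨M, hM, hMN⟩ := mem_nhds_subtype _ _ _ |>.1 hN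
    obtain ⟨U, hU, V, hV, hUV⟩ := mem_nhds_prod_iff.1 hM
    have h1 := hπ.isOpenMap.image_mem_nhds hV
    rw [← x.2] at h1
    filter_upwards [hU, f.continuous.continuousAt h1] with t ht ⟨p, hp, hpt⟩
    exact hMN (a := ⟨(t, p), hpt.symm⟩) (hUV ⟨ht, hp⟩)
  · intro x
    obtain ⟨e, he, hπe⟩ := hπ x.1.2
    refine ⟨_, e.open_source.preimage hc2, he, fun y hy z hz hyz => ?_⟩
    refine Subtype.ext (Prod.ext hyz (e.injOn hy hz ?_))
    rw [← hπe]
    change A.proj y.1.2 = A.proj z.1.2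
    rw [← y.2, ← z.2]
    exact congrArg f hyz

/-- The pullback of a bundle as a manifold with group action. -/
def pullbackGMan : GMan G :=
  etaleGMan T (PullbackSpace A f) (PullbackSpace.isLocalHomeomorph A f)
    (fun g => Continuous.subtype_mk ((continuous_fst.comp continuous_subtype_val).prodMk
      ((A.bundle.act g).continuous.comp (continuous_snd.comp continuous_subtype_val))) _)
    (fun _ _ => rfl)

theorem pullbackGMan_isPrincipalBundle :
    IsPrincipalBundle (pullbackGMan A f) (S := T)
      (etaleProj T (PullbackSpace A f) (PullbackSpace.isLocalHomeomorph A f)) where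
  surjective t := by
    obtain ⟨p, hp⟩ := A.isPrincipalBundle.surjective (f t)
    exact ⟨(⟨(t, p), hp.symm⟩ : PullbackSpace A f), rfl⟩
  isLocalDiffeomorph := isEtale_etaleSpace T _ _
  fibre (x : PullbackSpace A f) (y : PullbackSpace A f) := by
    constructor
    · intro (h : x.1.1 = y.1.1)
      obtain ⟨g, hg⟩ := (A.isPrincipalBundle.fibre x.1.2 y.1.2).1
        (x.2.symm.trans ((congrArg f h).trans y.2))
      exact ⟨g, Subtype.ext (Prod.ext h.symm hg)⟩
    · rintro ⟨g, rfl⟩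
      rfl
  free (x : PullbackSpace A f) g h :=
    A.isPrincipalBundle.free x.1.2 g (congrArg (fun x : PullbackSpace A f => x.1.2) h)

/-- The projection of the pullback to the total space of the bundle. -/
def pullbackTotal : (pullbackGMan A f).carrier ⟶ A.bundle.carrier :=
  ⟨fun x : PullbackSpace A f => x.1.2,
    IsEtale.contMDiff_of_comp_eq A.isPrincipalBundle.isEtale
      (continuous_snd.comp continuous_subtype_val)
      (etaleProj T (PullbackSpace A f) (PullbackSpace.isLocalHomeomorph A f) ≫ f)
      (fun x : PullbackSpace A f => x.2.symm)⟩

/-- The pullback of an object of the quotient stack. -/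
def QuotObj.pullback : QuotObj X where
  base := T
  bundle := pullbackGMan A f
  proj := etaleProj T (PullbackSpace A f) (PullbackSpace.isLocalHomeomorph A f)
  isPrincipalBundle := pullbackGMan_isPrincipalBundle A f
  map := pullbackTotal A f ≫ A.map
  map_equivariant g (x : PullbackSpace A f) := A.map_equivariant g x.1.2

/-- The morphism from the pullback of an object. -/
def QuotObj.pullbackHom : A.pullback f ⟶ A where
  base := f
  total := pullbackTotal A f
  equivariant _ _ := rfl
  proj_comm := AnMan.hom_ext fun x : PullbackSpace A f => x.2.symm
  map_comm := rfl

end Pullback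

/-- A bundle map identifies its source with the pullback of its target (`exists_lift`), so a
factorisation on bases lifts to total spaces. Equivariance and uniqueness follow from injectivity of
bundle maps on fibres. -/
theorem quotientStack_isFibredInGroupoids (X : GMan G) :
    IsFibredInGroupoids (quotientStack X) where
  exists_pullback (A : QuotObj X) _ f := ⟨A.pullback f, A.pullbackHom f,
    .map (p := (quotientStack X).p) (A.pullbackHom f)⟩
  existsUnique_lift {A B C : QuotObj X} (r : QuotHom B A) (s : QuotHom C A)
      (h : C.base ⟶ B.base) (hc : h ≫ r.base = s.base) := by
    have hc' : ∀ x, r.base (h x) = s.base x := fun x => congrArg (fun k : C.base ⟶ A.base => k x) hc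
    obtain ⟨l, hl, hl'⟩ := r.exists_lift (C.proj ≫ h) s.total (fun c => by
      rw [s.proj_total, ← hc', comp_apply])
    refine ⟨(⟨h, l, fun g c => ?_, AnMan.hom_ext hl, AnMan.hom_ext fun c => ?_⟩ : QuotHom C B),
      ⟨rfl, QuotHom.ext_total hl'⟩, ?_⟩
    · refine r.eq_of_total_eq ?_ ?_
      · rw [hl, MonoidHom.id_apply, B.isPrincipalBundle.proj_smul, hl, comp_apply, comp_apply,
          C.isPrincipalBundle.proj_smul]
      · rw [hl', MonoidHom.id_apply, r.total_smul, hl', s.total_smul]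
    · rw [comp_apply, ← r.map_total, hl', s.map_total]
    · rintro (t : QuotHom C B) ⟨ht, ht'⟩
      refine QuotHom.ext_total fun c => r.eq_of_total_eq ?_ ?_
      · rw [t.proj_total]
        exact (congrArg (fun k : C.base ⟶ B.base => k (C.proj c)) ht).trans (hl c).symm
      · have : r.total (t.total c) = s.total c := congrArg (fun k : QuotHom C A => k.total c) ht'
        exact this.trans (hl' c).symm

end PrincipalBundles

/-! ## Quotient stacks are stacks -/

section Stack

open AnMan

/-- Holomorphic maps can be glued along a jointly surjective family of étale maps. -/
theorem AnMan.exists_glue {ι : Type*} {E Y : AnMan} {J : ι → AnMan} {j : ∀ i, J i → E}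
    (hj : ∀ i, IsEtale (j i)) (hsurj : ∀ e, ∃ i a, j i a = e) (h : ∀ i, J i ⟶ Y)
    (hcompat : ∀ i k a b, j i a = j k b → h i a = h k b) :
    ∃ m : E ⟶ Y, ∀ i a, m (j i a) = h i a := by
  choose i a hia using hsurj
  have key : ∀ k b, h (i (j k b)) (a (j k b)) = h k b := fun k b => hcompat _ _ _ _ (hia _)
  refine ⟨⟨fun e => h (i e) (a e), fun e => ?_⟩, key⟩
  suffices HolAt (fun e => h (i e) (a e)) (j (i e) (a e)) by rwa [hia e] at this
  refine EtaleAt.holAt_of_comp_right (f := fun e => h (i e) (a e)) (hj (i e) (a e)) ?_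
  rw [show (fun e => h (i e) (a e)) ∘ j (i e) = h (i e) from funext fun b => key (i e) b]
  exact (h (i e)).contMDiff _

theorem AnMan.incl_injective {S : AnMan} (U : Opens S) : Function.Injective (S.incl U) :=
  Subtype.val_injective

theorem AnMan.inclLE_injective {S : AnMan} {U V : Opens S} (h : U ≤ V) :
    Function.Injective (S.inclLE h) := fun _ _ hxy =>
  Subtype.ext (congrArg (fun z : V => z.1) hxy)

theorem AnMan.isEtale_inclLE {S : AnMan} {U V : Opens S} (h : U ≤ V) : IsEtale (S.inclLE h) :=
  fun x => EtaleAt.of_comp_left (isEtale_incl V _) (S.inclLE h).continuous.continuousAt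
    (isEtale_incl U x)

variable {G : Type} [Group G] {X : GMan G}

/-- The projection of a bundle, whose base is equal to `T`. -/
def QuotObj.projTo (A : QuotObj X) {T : AnMan} (hA : A.base = T) : A.bundle.carrier ⟶ T :=
  A.proj ≫ eqToHom hA

section ProjTo

variable {A B : QuotObj X} {T T' : AnMan}

theorem QuotObj.isEtale_projTo (hA : A.base = T) : IsEtale (A.projTo hA) := by
  subst hA
  exact A.isPrincipalBundle.isEtale

theorem QuotObj.projTo_surjective (hA : A.base = T) : Function.Surjective (A.projTo hA) := by
  subst hA
  exact A.isPrincipalBundle.surjective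

theorem QuotObj.projTo_eq_iff (hA : A.base = T) (p q : A.bundle.carrier) :
    A.projTo hA p = A.projTo hA q ↔ ∃ g : G, q = op g • p := by
  subst hA
  exact A.isPrincipalBundle.fibre p q

theorem QuotHom.base_eq_of_isHomLift {f : B.base ⟶ A.base} (r : QuotHom B A)
    (h : (quotientStack X).p.IsHomLift f r) : f = r.base :=
  @CategoryTheory.IsHomLift.eq_of_isHomLift _ _ _ _ (quotientStack X).p _ _ f r h

theorem QuotHom.isHomLift_comp {C : QuotObj X} {T'' : AnMan} {f : T ⟶ T'} {f' : T' ⟶ T''}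
    (r : C ⟶ B) (s : B ⟶ A) (h : (quotientStack X).p.IsHomLift f r)
    (h' : (quotientStack X).p.IsHomLift f' s) : (quotientStack X).p.IsHomLift (f ≫ f') (r ≫ s) :=
  @CategoryTheory.IsHomLift.comp _ _ _ _ (quotientStack X).p _ _ _ _ _ _ f f' r s h h'

theorem QuotHom.exists_isHomLift_comp_eq {C : QuotObj X} {T'' : AnMan} {f : T ⟶ T'}
    {f' : T' ⟶ T''} (r : C ⟶ A) (s : B ⟶ A) (h : (quotientStack X).p.IsHomLift (f ≫ f') r)
    (h' : (quotientStack X).p.IsHomLift f' s) :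
    ∃ t : C ⟶ B, (quotientStack X).p.IsHomLift f t ∧ t ≫ s = r := by
  have := @IsFibredInGroupoids.isStronglyCartesian _ (quotientStack_isFibredInGroupoids X)
    _ _ _ _ _ s h'
  obtain ⟨t, ht, -⟩ := @Functor.IsStronglyCartesian.universal_property _ _ _ _
    (quotientStack X).p _ _ _ _ f' s this _ _ f (f ≫ f') rfl r h
  exact ⟨t, ht⟩

theorem QuotHom.projTo_total (hA : A.base = T') (hB : B.base = T) {f : T ⟶ T'} (r : QuotHom B A)
    (h : (quotientStack X).p.IsHomLift f r) (b : B.bundle.carrier) :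
    A.projTo hA (r.total b) = f (B.projTo hB b) := by
  subst hA hB
  obtain rfl := r.base_eq_of_isHomLift h
  exact r.proj_total b

theorem QuotHom.exists_total_eq_of_projTo (hA : A.base = T') (hB : B.base = T) {f : T ⟶ T'}
    (r : QuotHom B A) (h : (quotientStack X).p.IsHomLift f r) {t : T} {a : A.bundle.carrier}
    (ha : A.projTo hA a = f t) : ∃ b, B.projTo hB b = t ∧ r.total b = a := by
  subst hA hB
  obtain rfl := r.base_eq_of_isHomLift h
  exact r.exists_total_eq ha

theorem QuotHom.total_injective {f : T ⟶ T'} (r : QuotHom B A)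
    (h : (quotientStack X).p.IsHomLift f r) (hf : Function.Injective f) :
    Function.Injective r.total := by
  obtain ⟨⟩ := h
  intro b b' hb
  refine r.eq_of_total_eq (hf ?_) hb
  change r.base _ = r.base _
  rw [← r.proj_total, ← r.proj_total, hb]

theorem QuotHom.isEtale_total_of_isHomLift {f : T ⟶ T'} (r : QuotHom B A)
    (h : (quotientStack X).p.IsHomLift f r) (hf : IsEtale f) : IsEtale r.total := by
  obtain ⟨⟩ := h
  exact r.isEtale_total hf

end ProjTo

/-- The total spaces of the restrictions form an étale cover of the total space of `A`, so gluing
morphisms is gluing holomorphic maps along that cover. -/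
theorem quotientStack_glue_hom (S : AnMan) {ι : Type} (U : ι → Opens S) (hU : ⨆ i, U i = ⊤)
    (A B : QuotObj X) (hA : A.base = S) (hB : B.base = S)
    (A' : ι → QuotObj X) (r : ∀ i, A' i ⟶ A) (φ : ∀ i, A' i ⟶ B)
    (hr : ∀ i, (quotientStack X).p.IsHomLift (S.incl (U i)) (r i))
    (hφ : ∀ i, (quotientStack X).p.IsHomLift (S.incl (U i)) (φ i))
    (hc : ∀ i j (C : QuotObj X) (s : C ⟶ A' i) (t : C ⟶ A' j),
      (quotientStack X).p.IsHomLift (S.inclLE (inf_le_left : U i ⊓ U j ≤ U i)) s →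
      (quotientStack X).p.IsHomLift (S.inclLE (inf_le_right : U i ⊓ U j ≤ U j)) t →
      s ≫ r i = t ≫ r j → s ≫ φ i = t ≫ φ j) :
    ∃! ψ : A ⟶ B, (quotientStack X).p.IsHomLift (𝟙 S) ψ ∧ ∀ i, r i ≫ ψ = φ i := by
  have hfib := quotientStack_isFibredInGroupoids X
  have hA' : ∀ i, (A' i).base = S.restrict (U i) := fun i =>
    CategoryTheory.IsHomLift.domain_eq (quotientStack X).p (S.incl (U i)) (r i)
  have hsurj : ∀ e, ∃ i a, (r i).total a = e := by
    intro e
    obtain ⟨i, hi⟩ := Opens.mem_iSup.1 (hU ▸ Opens.mem_top (A.projTo hA e))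
    obtain ⟨a, -, ha⟩ := (r i).exists_total_eq_of_projTo hA (hA' i) (hr i)
      (t := (⟨A.projTo hA e, hi⟩ : U i)) (a := e) rfl
    exact ⟨i, a, ha⟩
  have hcompat : ∀ i k a b, (r i).total a = (r k).total b → (φ i).total a = (φ k).total b := by
    intro i k a b hab
    have h1 := (r i).projTo_total hA (hA' i) (hr i) a
    have h2 := (r k).projTo_total hA (hA' k) (hr k) b
    have hk : ((A' i).projTo (hA' i) a).1 ∈ U k := by
      rw [hab, h2] at h1
      exact (show S.incl (U i) ((A' i).projTo (hA' i) a) ∈ U k from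
        h1 ▸ ((A' k).projTo (hA' k) b).2)
    -- The hypothesis `hc` concerns objects over the overlap, not points. A common restriction `C`
    -- is built together with a point `c` mapping to `a` and to `b`.
    obtain ⟨C, s, hs⟩ := hfib.exists_isHomLift
      (S.inclLE (inf_le_left : U i ⊓ U k ≤ U i)) (A' i) (hA' i)
    have hC := CategoryTheory.IsHomLift.domain_eq (quotientStack X).p
      (S.inclLE (inf_le_left : U i ⊓ U k ≤ U i)) s
    have hsr := QuotHom.isHomLift_comp _ _ hs (hr i)
    obtain ⟨t, ht, htr⟩ := QuotHom.exists_isHomLift_comp_eq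
      (f := S.inclLE (inf_le_right : U i ⊓ U k ≤ U k)) (s ≫ r i) (r k) hsr (hr k)
    have h3 := hc i k C s t hs ht htr.symm
    obtain ⟨c, -, hca⟩ := QuotHom.exists_total_eq_of_projTo (hA' i) hC s hs
      (t := (⟨((A' i).projTo (hA' i) a).1, ((A' i).projTo (hA' i) a).2, hk⟩ : (U i ⊓ U k : Opens S)))
      (a := a) rfl
    have hcb : (toQuotHom t).total c = b := by
      refine (r k).total_injective (hr k) (incl_injective _) ?_
      rw [← hab, ← hca]
      exact congrArg (fun m : QuotHom C A => m.total c) htr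
    rw [← hca, ← hcb]
    exact congrArg (fun m : QuotHom C B => m.total c) h3
  obtain ⟨m, hm⟩ := AnMan.exists_glue (J := fun i => (A' i).bundle.carrier)
    (j := fun i => (r i).total)
    (fun i => (r i).isEtale_total_of_isHomLift (hr i) (isEtale_incl _)) hsurj
    (fun i => (φ i).total) hcompat
  have hproj : ∀ e, B.projTo hB (m e) = A.projTo hA e := by
    intro e
    obtain ⟨i, a, rfl⟩ := hsurj e
    rw [hm, (φ i).projTo_total hB (hA' i) (hφ i), (r i).projTo_total hA (hA' i) (hr i)]
  have huniq : ∀ ψ ψ' : A ⟶ B, (∀ i, r i ≫ ψ = φ i) → (∀ i, r i ≫ ψ' = φ i) → ψ = ψ' := by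
    intro ψ ψ' h h'
    refine QuotHom.ext_total fun e => ?_
    obtain ⟨i, a, rfl⟩ := hsurj e
    exact congrArg (fun m : QuotHom (A' i) B => m.total a) ((h i).trans (h' i).symm)
  have hex : ∃ ψ : QuotHom A B, (quotientStack X).p.IsHomLift (𝟙 S) ψ ∧
      ∀ a, ψ.total a = m a := by
    refine ⟨⟨eqToHom (hA.trans hB.symm), m, ?_, ?_, ?_⟩, ?_, fun _ => rfl⟩
    · intro g e
      obtain ⟨i, a, rfl⟩ := hsurj e
      rw [← (r i).total_smul, hm, (φ i).total_smul, hm, MonoidHom.id_apply]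
    · have h1 : (m ≫ B.proj) ≫ eqToHom hB = A.proj ≫ eqToHom hA := AnMan.hom_ext hproj
      rw [← cancel_mono (eqToHom hB), h1]
      simp
    · refine AnMan.hom_ext fun e => ?_
      obtain ⟨i, a, rfl⟩ := hsurj e
      rw [AnMan.comp_apply, hm, (φ i).map_total, (r i).map_total]
    · refine CategoryTheory.IsHomLift.of_fac' _ _ _ hA hB ?_
      exact (eqToHom_trans hA hB.symm).symm.trans
        (congrArg (eqToHom hA ≫ ·) (Category.id_comp _).symm)
  obtain ⟨ψ, hψ, hψm⟩ := hex
  have hψr : ∀ i, r i ≫ (ψ : A ⟶ B) = φ i := fun i => QuotHom.ext_total fun a =>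
    (hψm _).trans (hm i a)
  exact ⟨ψ, ⟨hψ, hψr⟩, fun ψ' h' => huniq _ _ h'.2 hψr⟩

end Stack

/-! ## Gluing of principal bundles -/

section TopologicalBundles

variable {G : Type*} [Group G] {P S : Type*} [TopologicalSpace P] [TopologicalSpace S]
  [MulAction Gᵐᵒᵖ P] {π : P → S}

/-- A space with a free group action which is étale over the Hausdorff space of orbits is
Hausdorff. -/
theorem IsLocalHomeomorph.t2Space_of_fibre [T2Space S] (h : IsLocalHomeomorph π)
    (hc : ∀ g : G, Continuous fun p : P => op g • p)
    (hfib : ∀ p q, π p = π q ↔ ∃ g : G, q = op g • p)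
    (hfree : ∀ (p : P) (g : G), op g • p = p → g = 1) : T2Space P := by
  refine ⟨fun p q hpq => ?_⟩
  by_cases hπ : π p = π q
  · obtain ⟨g, rfl⟩ := (hfib p q).1 hπ
    obtain ⟨e, he, hπe⟩ := h p
    -- Two points of one fibre are separated by a sheet and its translate by `g`: if `z` and `z ·
    -- g⁻¹` lay in the same sheet they would coincide, and freeness would force `g = 1`.
    refine ⟨e.source, {z | op g⁻¹ • z ∈ e.source}, e.open_source,
      e.open_source.preimage (hc g⁻¹), he, ?_, ?_⟩
    · change op g⁻¹ • op g • p ∈ e.source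
      simpa using he
    · refine Set.disjoint_left.2 fun z hz (hz' : op g⁻¹ • z ∈ e.source) => hpq ?_
      have h1 : op g⁻¹ • z = z := e.injOn hz' hz (by
        rw [← hπe]
        exact ((hfib z _).2 ⟨g⁻¹, rfl⟩).symm)
      have h2 : g = 1 := inv_eq_one.1 (hfree z _ h1)
      simp [h2]
  · obtain ⟨U, V, hU, hV, hp, hq, hUV⟩ := t2_separation hπ
    exact ⟨π ⁻¹' U, π ⁻¹' V, hU.preimage h.continuous, hV.preimage h.continuous, hp, hq,
      hUV.preimage π⟩

/-- A space with an action of a countable group which is étale over the second countable space of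
orbits is second countable. -/
theorem IsLocalHomeomorph.secondCountableTopology_of_fibre [Countable G]
    [SecondCountableTopology S] (h : IsLocalHomeomorph π) (hsurj : Function.Surjective π)
    (hc : ∀ g : G, Continuous fun p : P => op g • p)
    (hfib : ∀ p q, π p = π q ↔ ∃ g : G, q = op g • p) : SecondCountableTopology P := by
  choose σ hσ using hsurj
  choose e he hπe using fun s => h (σ s)
  have hnhds : ∀ s, π '' (e s).source ∈ nhds s := fun s => by
    have := h.isOpenMap.image_mem_nhds ((e s).open_source.mem_nhds (he s))
    rwa [hσ] at this
  obtain ⟨c, hcc, hcu⟩ := TopologicalSpace.countable_cover_nhds hnhds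
  have := hcc.to_subtype
  -- All translates of countably many sheets: a countable open cover, each member of which `π`
  -- embeds in `S`.
  let W : c × G → Set P := fun x => {z | op x.2⁻¹ • z ∈ (e x.1).source}
  have hπg : ∀ (g : G) z, π (op g • z) = π z := fun g z => ((hfib z _).2 ⟨g, rfl⟩).symm
  have hW : ∀ x, IsOpen (W x) := fun x => (e x.1).open_source.preimage (hc _)
  have hWi : ∀ x, Set.InjOn π (W x) := by
    intro x y hy z hz hyz
    have h1 : op x.2⁻¹ • y = op x.2⁻¹ • z := (e x.1).injOn hy hz (by
      rw [← hπe, hπg, hπg, hyz])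
    exact smul_left_cancel _ h1
  have hsc : ∀ x, SecondCountableTopology (W x) := fun x =>
    (Topology.IsOpenEmbedding.of_continuous_injective_isOpenMap
      (h.continuous.comp continuous_subtype_val) (Set.injOn_iff_injective.1 (hWi x))
      (h.isOpenMap.domRestrict (hW x))).isEmbedding.secondCountableTopology
  refine TopologicalSpace.secondCountableTopology_of_countable_cover hW
    (Set.eq_univ_of_forall fun z => ?_)
  have hz : π z ∈ ⋃ s ∈ c, π '' (e s).source := hcu ▸ Set.mem_univ _
  obtain ⟨s, hs, y, hy, hyz⟩ := Set.mem_iUnion₂.1 hz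
  obtain ⟨g, rfl⟩ := (hfib y z).1 hyz
  refine Set.mem_iUnion.2 ⟨(⟨s, hs⟩, g), ?_⟩
  change op g⁻¹ • op g • y ∈ (e s).source
  simpa using hy

end TopologicalBundles

/-! ### Descent data and the relation they define on points -/

section GlueObj

open AnMan

variable {G : Type} [Group G] {X : GMan G}

/-- A descent datum for objects of a quotient stack. -/
structure QuotDescentDatum (X : GMan G) {S : AnMan} {ι : Type} (U : ι → Opens S) where
  A : ι → QuotObj X
  Z : ι → ι → QuotObj X
  a : ∀ i j, Z i j ⟶ A i
  b : ∀ i j, Z i j ⟶ A j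
  base_eq : ∀ i, (A i).base = S.restrict (U i)
  isHomLift_a : ∀ i j, (quotientStack X).p.IsHomLift
    (S.inclLE (inf_le_left : U i ⊓ U j ≤ U i)) (a i j)
  isHomLift_b : ∀ i j, (quotientStack X).p.IsHomLift
    (S.inclLE (inf_le_right : U i ⊓ U j ≤ U j)) (b i j)
  refl : ∀ i, a i i = b i i
  cocycle : ∀ i j k (W : QuotObj X) (s : W ⟶ Z i j) (t : W ⟶ Z j k) (u : W ⟶ Z i k),
      (quotientStack X).p.IsHomLift (S.inclLE (inf_le_left : U i ⊓ U j ⊓ U k ≤ U i ⊓ U j)) s →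
      (quotientStack X).p.IsHomLift (S.inclLE (inf_le_inf_right (U k) inf_le_right :
        U i ⊓ U j ⊓ U k ≤ U j ⊓ U k)) t →
      (quotientStack X).p.IsHomLift (S.inclLE (inf_le_inf_right (U k) inf_le_left :
        U i ⊓ U j ⊓ U k ≤ U i ⊓ U k)) u →
      s ≫ a i j = u ≫ a i k → s ≫ b i j = t ≫ a j k → t ≫ b j k = u ≫ b i k

namespace QuotDescentDatum

variable {S : AnMan} {ι : Type} {U : ι → Opens S} (D : QuotDescentDatum X U)

theorem base_eq_Z (i j : ι) : (D.Z i j).base = S.restrict (U i ⊓ U j) :=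
  @CategoryTheory.IsHomLift.domain_eq _ _ _ _ (quotientStack X).p _ _ _ _ _ (D.a i j)
    (D.isHomLift_a i j)

/-- The projection of the local bundle to `S`. -/
def proj (i : ι) : (D.A i).bundle.carrier ⟶ S :=
  (D.A i).projTo (D.base_eq i) ≫ S.incl (U i)

theorem isEtale_proj (i : ι) : IsEtale (D.proj i) :=
  (isEtale_incl (U i)).comp ((D.A i).isEtale_projTo (D.base_eq i))

theorem proj_mem (i : ι) (p : (D.A i).bundle.carrier) : D.proj i p ∈ U i :=
  ((D.A i).projTo (D.base_eq i) p).2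

theorem exists_proj_eq (i : ι) {s : S} (hs : s ∈ U i) : ∃ p, D.proj i p = s := by
  obtain ⟨p, hp⟩ := (D.A i).projTo_surjective (D.base_eq i) (⟨s, hs⟩ : U i)
  exact ⟨p, congrArg (fun x : U i => x.1) hp⟩

theorem proj_eq_iff (i : ι) (p q : (D.A i).bundle.carrier) :
    D.proj i p = D.proj i q ↔ ∃ g : G, q = op g • p :=
  (incl_injective (U i)).eq_iff.trans ((D.A i).projTo_eq_iff (D.base_eq i) p q)

theorem proj_a (i j : ι) (z : (D.Z i j).bundle.carrier) :
    D.proj i ((D.a i j).total z) = ((D.Z i j).projTo (D.base_eq_Z i j) z).1 :=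
  congrArg (fun x : U i => x.1)
    ((D.a i j).projTo_total (D.base_eq i) (D.base_eq_Z i j) (D.isHomLift_a i j) z)

theorem proj_b (i j : ι) (z : (D.Z i j).bundle.carrier) :
    D.proj j ((D.b i j).total z) = ((D.Z i j).projTo (D.base_eq_Z i j) z).1 :=
  congrArg (fun x : U j => x.1)
    ((D.b i j).projTo_total (D.base_eq j) (D.base_eq_Z i j) (D.isHomLift_b i j) z)

theorem exists_a_eq (i j : ι) {p : (D.A i).bundle.carrier} (hp : D.proj i p ∈ U j) :
    ∃ z, (D.a i j).total z = p := by
  obtain ⟨z, -, hz⟩ := (D.a i j).exists_total_eq_of_projTo (D.base_eq i) (D.base_eq_Z i j)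
    (D.isHomLift_a i j) (t := (⟨D.proj i p, D.proj_mem i p, hp⟩ : (U i ⊓ U j : Opens S)))
    (a := p) rfl
  exact ⟨z, hz⟩

theorem a_injective (i j : ι) : Function.Injective (D.a i j).total :=
  (D.a i j).total_injective (D.isHomLift_a i j) (inclLE_injective _)

/-- The identification of points of the local bundles. -/
def Rel (x y : Σ i, (D.A i).bundle.carrier) : Prop :=
  ∃ z : (D.Z x.1 y.1).bundle.carrier, (D.a x.1 y.1).total z = x.2 ∧ (D.b x.1 y.1).total z = y.2

theorem Rel.proj_eq {x y : Σ i, (D.A i).bundle.carrier} (h : D.Rel x y) :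
    D.proj x.1 x.2 = D.proj y.1 y.2 := by
  obtain ⟨z, h1, h2⟩ := h
  rw [← h1, ← h2, proj_a, proj_b]

/-- The normalisation `a i i = b i i` prevents a local bundle from being glued to itself
nontrivially; each local bundle therefore embeds in the quotient. -/
theorem rel_same_iff (i : ι) (p q : (D.A i).bundle.carrier) :
    D.Rel ⟨i, p⟩ ⟨i, q⟩ ↔ p = q := by
  constructor
  · rintro ⟨z, h1, h2⟩
    change (D.a i i).total z = p at h1
    change (D.b i i).total z = q at h2
    rw [← h1, ← h2, D.refl]
  · rintro rfl
    obtain ⟨z, hz⟩ := D.exists_a_eq i i (D.proj_mem i p)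
    refine ⟨z, hz, ?_⟩
    change (D.b i i).total z = p
    rw [← D.refl, hz]

theorem exists_rel (x : Σ i, (D.A i).bundle.carrier) (j : ι) (h : D.proj x.1 x.2 ∈ U j) :
    ∃ q, D.Rel x ⟨j, q⟩ := by
  obtain ⟨z, hz⟩ := D.exists_a_eq x.1 j h
  exact ⟨(D.b x.1 j).total z, z, hz, rfl⟩

/-- This is the cocycle condition evaluated at a point. An object `W` over the triple overlap is
mapped to all three of the `Z`, with a point `w` whose images are the given witnesses `z`, `z'` and
the candidate `z''`. -/
theorem Rel.trans {x y w : Σ i, (D.A i).bundle.carrier} (h : D.Rel x y) (h' : D.Rel y w) :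
    D.Rel x w := by
  have hxy := h.proj_eq
  have hyw := h'.proj_eq
  obtain ⟨i, p⟩ := x
  obtain ⟨j, q⟩ := y
  obtain ⟨k, v⟩ := w
  obtain ⟨z, hz1, hz2⟩ := h
  obtain ⟨z', hz1', hz2'⟩ := h'
  dsimp only at *
  have hfib := quotientStack_isFibredInGroupoids X
  have hpj : D.proj i p ∈ U j := hxy ▸ D.proj_mem j q
  have hpk : D.proj i p ∈ U k := hxy ▸ hyw ▸ D.proj_mem k v
  obtain ⟨z'', hz''⟩ := D.exists_a_eq i k hpk
  obtain ⟨W, u, hu⟩ := hfib.exists_isHomLift (S.inclLE (inf_le_inf_right (U k) inf_le_left :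
        U i ⊓ U j ⊓ U k ≤ U i ⊓ U k)) (D.Z i k) (D.base_eq_Z i k)
  have hW := CategoryTheory.IsHomLift.domain_eq (quotientStack X).p
    (S.inclLE (inf_le_inf_right (U k) inf_le_left : U i ⊓ U j ⊓ U k ≤ U i ⊓ U k)) u
  have hua := QuotHom.isHomLift_comp _ _ hu (D.isHomLift_a i k)
  obtain ⟨s, hs, hsa⟩ := QuotHom.exists_isHomLift_comp_eq
    (f := S.inclLE (inf_le_left : U i ⊓ U j ⊓ U k ≤ U i ⊓ U j)) (u ≫ D.a i k) (D.a i j)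
    hua (D.isHomLift_a i j)
  have hsb := QuotHom.isHomLift_comp _ _ hs (D.isHomLift_b i j)
  obtain ⟨t, ht, hta⟩ := QuotHom.exists_isHomLift_comp_eq
    (f := S.inclLE (inf_le_inf_right (U k) inf_le_right : U i ⊓ U j ⊓ U k ≤ U j ⊓ U k))
    (s ≫ D.b i j) (D.a j k) hsb (D.isHomLift_a j k)
  have key := D.cocycle i j k W s t u hs ht hu hsa hta.symm
  obtain ⟨w, -, hw⟩ := QuotHom.exists_total_eq_of_projTo (D.base_eq_Z i k) hW u hu
    (t := (⟨D.proj i p, ⟨D.proj_mem i p, hpj⟩, hpk⟩ : (U i ⊓ U j ⊓ U k : Opens S))) (a := z'')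
    (Subtype.ext (by rw [← D.proj_a, hz'']; rfl))
  have e1 : (toQuotHom s).total w = z := D.a_injective i j (by
    rw [hz1, ← hz'', ← hw]
    exact congrArg (fun m : QuotHom W (D.A i) => m.total w) hsa)
  have e2 : (toQuotHom t).total w = z' := D.a_injective j k (by
    rw [hz1', ← hz2, ← e1]
    exact congrArg (fun m : QuotHom W (D.A j) => m.total w) hta)
  refine ⟨z'', hz'', ?_⟩
  rw [← hz2', ← e2, ← hw]
  exact (congrArg (fun m : QuotHom W (D.A k) => m.total w) key).symm

end QuotDescentDatum

end GlueObj

/-! ### The total space of the glued bundle -/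

section GlueObjQuotient

open AnMan

variable {G : Type} [Group G] {X : GMan G}

namespace QuotDescentDatum

variable {S : AnMan} {ι : Type} {U : ι → Opens S} (D : QuotDescentDatum X U)

/-- The datum does not directly relate `Z i j` to `Z j i`. Instead `y` is related to some point of
the bundle of `x`, and transitivity with `rel_same_iff` shows that this point is `x`. -/
theorem Rel.symm {x y : Σ i, (D.A i).bundle.carrier} (h : D.Rel x y) : D.Rel y x := by
  obtain ⟨p, hp⟩ := D.exists_rel y x.1 (h.proj_eq ▸ D.proj_mem x.1 x.2)
  have h1 : D.Rel ⟨x.1, x.2⟩ ⟨x.1, p⟩ := h.trans D hp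
  rw [rel_same_iff] at h1
  rwa [← h1] at hp

theorem Rel.smul {x y : Σ i, (D.A i).bundle.carrier} (h : D.Rel x y) (g : G) :
    D.Rel ⟨x.1, op g • x.2⟩ ⟨y.1, op g • y.2⟩ := by
  obtain ⟨z, h1, h2⟩ := h
  refine ⟨op g • z, ?_, ?_⟩
  · rw [QuotHom.total_smul, h1]
  · rw [QuotHom.total_smul, h2]

theorem Rel.map_eq {x y : Σ i, (D.A i).bundle.carrier} (h : D.Rel x y) :
    (D.A x.1).map x.2 = (D.A y.1).map y.2 := by
  obtain ⟨z, h1, h2⟩ := h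
  rw [← h1, ← h2, QuotHom.map_total, QuotHom.map_total]

/-- The identification of points of the local bundles, as an equivalence relation. -/
def setoid : Setoid (Σ i, (D.A i).bundle.carrier) where
  r := D.Rel
  iseqv := ⟨fun x => (D.rel_same_iff x.1 x.2 x.2).2 rfl, fun h => h.symm D, fun h h' => h.trans D h'⟩

/-- The total space obtained by gluing the local bundles. -/
def Glued : Type := Quotient D.setoid

instance : TopologicalSpace D.Glued := inferInstanceAs (TopologicalSpace (Quotient D.setoid))

/-- The map from a local bundle to the glued total space. -/
def glue (i : ι) (p : (D.A i).bundle.carrier) : D.Glued := Quotient.mk D.setoid ⟨i, p⟩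

theorem exists_glue_eq (x : D.Glued) : ∃ i p, D.glue i p = x := by
  obtain ⟨⟨i, p⟩, rfl⟩ := Quotient.exists_rep x
  exact ⟨i, p, rfl⟩

theorem glue_eq_iff {i j : ι} {p : (D.A i).bundle.carrier} {q : (D.A j).bundle.carrier} :
    D.glue i p = D.glue j q ↔ D.Rel ⟨i, p⟩ ⟨j, q⟩ := Quotient.eq (r := D.setoid)

theorem exists_glue_eq_of_mem {i j : ι} {p : (D.A i).bundle.carrier} (h : D.proj i p ∈ U j) :
    ∃ q, D.glue i p = D.glue j q := by
  obtain ⟨q, hq⟩ := D.exists_rel ⟨i, p⟩ j h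
  exact ⟨q, D.glue_eq_iff.2 hq⟩

theorem glue_injective (i : ι) : Function.Injective (D.glue i) := fun p q h =>
  (D.rel_same_iff i p q).1 (D.glue_eq_iff.1 h)

theorem continuous_glue (i : ι) : Continuous (D.glue i) :=
  continuous_quotient_mk'.comp continuous_sigmaMk

/-- The saturation of an open set meets the `j`-th bundle in the image under `b i j` of a preimage
under `a i j`, and `b i j` is étale, hence open. -/
theorem isOpenMap_glue (i : ι) : IsOpenMap (D.glue i) := by
  intro O hO
  refine isOpen_coinduced.2 (isOpen_sigma_iff.2 fun j => ?_)
  have h1 : Sigma.mk j ⁻¹' (Quotient.mk D.setoid ⁻¹' (D.glue i '' O)) =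
      (D.b i j).total '' ((D.a i j).total ⁻¹' O) := by
    ext q
    constructor
    · rintro ⟨p, hp, hpq⟩
      obtain ⟨z, hz1, hz2⟩ := D.glue_eq_iff.1 hpq
      refine ⟨z, ?_, hz2⟩
      rwa [Set.mem_preimage, hz1]
    · rintro ⟨z, hz, rfl⟩
      exact ⟨_, hz, D.glue_eq_iff.2 ⟨z, rfl, rfl⟩⟩
  have hb := (D.b i j).isEtale_total_of_isHomLift (D.isHomLift_b i j) (isEtale_inclLE _)
  exact h1 ▸ hb.isOpenMap _ (hO.preimage (D.a i j).total.continuous)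

/-- The projection of the glued total space. -/
def gluedProj : D.Glued → S :=
  Quotient.lift (fun x => D.proj x.1 x.2) fun _ _ (h : D.Rel _ _) => h.proj_eq

theorem gluedProj_glue (i : ι) (p : (D.A i).bundle.carrier) :
    D.gluedProj (D.glue i p) = D.proj i p := rfl

theorem continuous_gluedProj : Continuous D.gluedProj :=
  continuous_quot_lift _ (continuous_sigma fun i => (D.proj i).continuous)

theorem isLocalHomeomorph_gluedProj : IsLocalHomeomorph D.gluedProj := by
  refine isLocalHomeomorph_of_isOpenMap D.continuous_gluedProj ?_ ?_
  · refine IsOpenMap.of_nhds_le fun x N hN => ?_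
    obtain ⟨i, p, rfl⟩ := D.exists_glue_eq x
    have h1 := (D.isEtale_proj i).isOpenMap.image_mem_nhds
      ((D.continuous_glue i).continuousAt.preimage_mem_nhds (Filter.mem_map.1 hN))
    rw [gluedProj_glue]
    refine Filter.mem_of_superset h1 ?_
    rintro _ ⟨q, hq, rfl⟩
    exact hq
  · intro x
    obtain ⟨i, p, rfl⟩ := D.exists_glue_eq x
    obtain ⟨e, he, hπe⟩ := (D.isEtale_proj i).isLocalHomeomorph p
    refine ⟨_, D.isOpenMap_glue i _ e.open_source, ⟨p, he, rfl⟩, ?_⟩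
    rintro _ ⟨q, hq, rfl⟩ _ ⟨q', hq', rfl⟩ hqq
    rw [gluedProj_glue, gluedProj_glue, hπe] at hqq
    rw [e.injOn hq hq' hqq]

instance : MulAction Gᵐᵒᵖ D.Glued where
  smul g := Quotient.map (fun x => ⟨x.1, g • x.2⟩) fun _ _ (h : D.Rel _ _) => h.smul D g.unop
  one_smul x := by
    obtain ⟨i, p, rfl⟩ := D.exists_glue_eq x
    exact congrArg (D.glue i) (one_smul _ p)
  mul_smul g h x := by
    obtain ⟨i, p, rfl⟩ := D.exists_glue_eq x
    exact congrArg (D.glue i) (mul_smul g h p)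

theorem smul_glue (g : G) (i : ι) (p : (D.A i).bundle.carrier) :
    op g • D.glue i p = D.glue i (op g • p) := rfl

theorem continuous_smul_glued (g : G) : Continuous fun x : D.Glued => op g • x :=
  continuous_quot_lift _ (continuous_sigma fun i =>
    (D.continuous_glue i).comp ((D.A i).bundle.act g).continuous)

theorem gluedProj_eq_iff (x y : D.Glued) :
    D.gluedProj x = D.gluedProj y ↔ ∃ g : G, y = op g • x := by
  obtain ⟨i, p, rfl⟩ := D.exists_glue_eq x
  obtain ⟨j, q, rfl⟩ := D.exists_glue_eq y
  constructor
  · intro h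
    rw [gluedProj_glue, gluedProj_glue] at h
    obtain ⟨q', hq'⟩ := D.exists_glue_eq_of_mem (p := q) (h ▸ D.proj_mem i p)
    have h1 : D.proj i p = D.proj i q' := by
      rw [h, ← gluedProj_glue, hq', gluedProj_glue]
    obtain ⟨g, rfl⟩ := (D.proj_eq_iff i p q').1 h1
    exact ⟨g, hq'⟩
  · rintro ⟨g, hg⟩
    rw [hg, smul_glue, gluedProj_glue, gluedProj_glue]
    exact (D.proj_eq_iff i p _).2 ⟨g, rfl⟩

theorem eq_one_of_smul_glued (x : D.Glued) (g : G) (h : op g • x = x) : g = 1 := by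
  obtain ⟨i, p, rfl⟩ := D.exists_glue_eq x
  rw [smul_glue] at h
  exact (D.A i).isPrincipalBundle.free p g (D.glue_injective i h)

theorem gluedProj_surjective (hU : ⨆ i, U i = ⊤) : Function.Surjective D.gluedProj := by
  intro s
  obtain ⟨i, hi⟩ := Opens.mem_iSup.1 (hU ▸ Opens.mem_top s)
  obtain ⟨p, hp⟩ := D.exists_proj_eq i hi
  exact ⟨D.glue i p, hp⟩

/-- The quotient is étale over `S` with a free action whose orbits are the fibres, so it inherits
from `S` a manifold structure, the Hausdorff property and, `G` being countable, second countability.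
-/
theorem exists_glued [Countable G] (hU : ⨆ i, U i = ⊤) :
    ∃ (E : QuotObj X) (ρ : ∀ i, D.A i ⟶ E), E.base = S ∧
      (∀ i, (quotientStack X).p.IsHomLift (S.incl (U i)) (ρ i)) ∧
      ∀ i j, D.a i j ≫ ρ i = D.b i j ≫ ρ j := by
  have hT : T2Space D.Glued := D.isLocalHomeomorph_gluedProj.t2Space_of_fibre
    D.continuous_smul_glued D.gluedProj_eq_iff D.eq_one_of_smul_glued
  have hC : SecondCountableTopology D.Glued :=
    D.isLocalHomeomorph_gluedProj.secondCountableTopology_of_fibre (D.gluedProj_surjective hU)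
      D.continuous_smul_glued D.gluedProj_eq_iff
  let P : GMan G := etaleGMan S D.Glued D.isLocalHomeomorph_gluedProj D.continuous_smul_glued
    fun g x => ((D.gluedProj_eq_iff x _).2 ⟨g, rfl⟩).symm
  let π : P.carrier ⟶ S := etaleProj S D.Glued D.isLocalHomeomorph_gluedProj
  have hπ : IsEtale π := isEtale_etaleSpace S D.Glued D.isLocalHomeomorph_gluedProj
  let m : ∀ i, (D.A i).bundle.carrier ⟶ P.carrier := fun i => ⟨D.glue i,
    IsEtale.contMDiff_of_comp_eq (Y := P.carrier) hπ (D.continuous_glue i) (D.proj i) fun _ => rfl⟩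
  have hm : ∀ i, IsEtale (m i) := fun i p =>
    EtaleAt.of_comp_left (hπ _) (m i).continuous.continuousAt (D.isEtale_proj i p)
  obtain ⟨u, hu⟩ := AnMan.exists_glue (E := P.carrier) hm D.exists_glue_eq (fun i => (D.A i).map)
    fun i j p q h => Rel.map_eq D (D.glue_eq_iff.1 h)
  let E : QuotObj X :=
    { base := S
      bundle := P
      proj := π
      isPrincipalBundle := ⟨D.gluedProj_surjective hU, hπ, D.gluedProj_eq_iff,
        D.eq_one_of_smul_glued⟩
      map := u
      map_equivariant := fun g x => by
        obtain ⟨i, p, rfl⟩ := D.exists_glue_eq x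
        exact (hu i (op g • p)).trans (((D.A i).map_equivariant g p).trans
          (congrArg (op g • ·) (hu i p).symm)) }
  let ρ : ∀ i, D.A i ⟶ E := fun i => (⟨eqToHom (D.base_eq i) ≫ S.incl (U i), m i, fun _ _ => rfl,
    AnMan.hom_ext fun p => rfl, AnMan.hom_ext (hu i)⟩ : QuotHom (D.A i) E)
  refine ⟨E, ρ, rfl, fun i => ?_, fun i j => QuotHom.ext_total fun z => ?_⟩
  · exact CategoryTheory.IsHomLift.of_fac' (quotientStack X).p _ _ (D.base_eq i) rfl
      (congrArg (eqToHom (D.base_eq i) ≫ ·) (Category.comp_id _).symm)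
  · exact D.glue_eq_iff.2 ⟨z, rfl, rfl⟩

end QuotDescentDatum

/-- The quotient stack of a countable discrete group is a stack. -/
theorem quotientStack_isStack [Countable G] (X : GMan G) : IsStack (quotientStack X) where
  isFibredInGroupoids := quotientStack_isFibredInGroupoids X
  glue_hom S _ U hU A B hA hB A' r φ hr hφ hc :=
    quotientStack_glue_hom S U hU A B hA hB A' r φ hr hφ hc
  glue_obj _ _ _ hU A Z a b hA ha hb hab hc :=
    (QuotDescentDatum.mk A Z a b hA ha hb hab hc).exists_glued hU

end GlueObjQuotient

/-! ## The canonical atlas -/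

section Atlas

open AnMan

variable {G : Type} [Group G] {X : GMan G}

section ProjToLift

variable {A B : QuotObj X} {T T' : AnMan}

theorem QuotHom.eq_of_total_eq_of_projTo (hB : B.base = T) (r : QuotHom B A)
    {b b' : B.bundle.carrier} (h : B.projTo hB b = B.projTo hB b') (h' : r.total b = r.total b') :
    b = b' := by
  subst hB
  exact r.eq_of_total_eq h h'

theorem QuotHom.exists_section (hA : A.base = T') (hB : B.base = T) {f : T ⟶ T'} (r : QuotHom B A)
    (h : (quotientStack X).p.IsHomLift f r) (k : T ⟶ A.bundle.carrier)
    (hk : ∀ t, A.projTo hA (k t) = f t) :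
    ∃ l : T ⟶ B.bundle.carrier, (∀ t, B.projTo hB (l t) = t) ∧ ∀ t, r.total (l t) = k t := by
  subst hA hB
  obtain rfl := r.base_eq_of_isHomLift h
  exact r.exists_lift (𝟙 _) k hk

/-- A holomorphic section of a bundle is étale. -/
theorem QuotObj.isEtale_section (hA : A.base = T) (σ : T ⟶ A.bundle.carrier)
    (hσ : ∀ t, A.projTo hA (σ t) = t) : IsEtale σ := fun t =>
  EtaleAt.of_comp_left (A.isEtale_projTo hA _) σ.continuous.continuousAt (by
    rw [show (A.projTo hA : A.bundle.carrier → T) ∘ σ = (𝟙 T : T ⟶ T) from funext hσ]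
    exact isEtale_of_iso (𝟙 T) (Category.comp_id _) (Category.comp_id _) t)

/-- Étale maps have local sections. -/
theorem AnMan.exists_local_section {P S : AnMan} {π : P ⟶ S} (hπ : IsEtale π) (p : P) :
    ∃ V : Opens S, π p ∈ V ∧ ∃ s : S.restrict V ⟶ P, ∀ t, π (s t) = S.incl V t := by
  have h := hπ p
  let V : Opens S := ⟨h.localInverse.source, h.localInverse_open_source⟩
  have hs : ContMDiff 𝓘(ℂ, S.E) 𝓘(ℂ, P.E) ω (fun t : V => h.localInverse t.1) := fun t =>
    ContMDiffAt.comp (I' := 𝓘(ℂ, S.E)) t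
      (h.localInverse_contMDiffOn.contMDiffAt (V.isOpen.mem_nhds t.2)) ((S.incl V).contMDiff t)
  exact ⟨V, h.localInverse_mem_source, ⟨_, hs⟩, fun t => h.localInverse_right_inv t.2⟩

end ProjToLift

section AtlasObj

variable (p : X.carrier.stack ⥤ᵇ quotientStack X)

/-- The bundle over the source of `f` given by an atlas. -/
def atlasObj (f : Over X.carrier) : QuotObj X := p.obj f

/-- The bundle map given by an atlas. -/
def atlasMap {f g : Over X.carrier} (k : f ⟶ g) : QuotHom (atlasObj p f) (atlasObj p g) := p.map k

theorem atlasObj_base (f : Over X.carrier) : (atlasObj p f).base = f.left := p.w_obj f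

theorem isHomLift_atlasMap {f g : Over X.carrier} (k : f ⟶ g) :
    (quotientStack X).p.IsHomLift k.left (atlasMap p k) :=
  @BasedFunctor.preserves_isHomLift _ _ _ _ p _ _ _ _ k.left k
    (CategoryTheory.IsHomLift.map (Over.forget X.carrier) k)

theorem atlasMap_comp_total {f g h : Over X.carrier} (k : f ⟶ g) (l : g ⟶ h)
    (b : (atlasObj p f).bundle.carrier) :
    (atlasMap p (k ≫ l)).total b = (atlasMap p l).total ((atlasMap p k).total b) :=
  congrArg (fun m : QuotHom (atlasObj p f) (atlasObj p h) => m.total b) (p.toFunctor.map_comp k l)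

theorem atlasMap_projTo {f g : Over X.carrier} (k : f ⟶ g) (b : (atlasObj p f).bundle.carrier) :
    (atlasObj p g).projTo (atlasObj_base p g) ((atlasMap p k).total b) =
      k.left ((atlasObj p f).projTo (atlasObj_base p f) b) :=
  (atlasMap p k).projTo_total _ _ (isHomLift_atlasMap p k) b

end AtlasObj

/-- Compatible sections of the bundles given by a canonical atlas. -/
structure AtlasSections (p : X.carrier.stack ⥤ᵇ quotientStack X) where
  σ : ∀ f : Over X.carrier, f.left ⟶ (atlasObj p f).bundle.carrier
  projTo_σ : ∀ f t, (atlasObj p f).projTo (atlasObj_base p f) (σ f t) = t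
  map_σ : ∀ f t, (atlasObj p f).map (σ f t) = f.hom t
  total_σ : ∀ {f g : Over X.carrier} (k : f ⟶ g) (t : f.left),
    (atlasMap p k).total (σ f t) = σ g (k.left t)

/-- The identity is terminal among manifolds over `X`, so the section over it pulls back to every
bundle of the atlas; fibrewise injectivity of bundle maps makes the pullbacks compatible. -/
theorem IsCanonicalAtlas.nonempty_sections {p : X.carrier.stack ⥤ᵇ quotientStack X}
    (hp : IsCanonicalAtlas X p) : Nonempty (AtlasSections p) := by
  let i : Over X.carrier := Over.mk (𝟙 X.carrier)
  let P : QuotObj X := atlasObj p i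
  have hP : P.base = X.carrier := atlasObj_base p i
  obtain ⟨σ, h1, h2⟩ : ∃ σ : P.base ⟶ P.bundle.carrier, σ ≫ P.proj = 𝟙 P.base ∧
    σ ≫ P.map = eqToHom hP := hp
  let σ₀ : X.carrier ⟶ P.bundle.carrier := eqToHom hP.symm ≫ σ
  have h1' : ∀ x, P.projTo hP (σ₀ x) = x := fun x => by
    have h : σ₀ ≫ P.projTo hP = 𝟙 X.carrier := by
      change (eqToHom hP.symm ≫ σ) ≫ P.proj ≫ eqToHom hP = _
      rw [Category.assoc, reassoc_of% h1]
      simp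
    exact congrArg (fun k : X.carrier ⟶ X.carrier => k x) h
  have h2' : ∀ x, P.map (σ₀ x) = x := fun x => by
    have h : σ₀ ≫ P.map = 𝟙 X.carrier := by
      change (eqToHom hP.symm ≫ σ) ≫ P.map = _
      rw [Category.assoc, h2]
      exact eqToHom_trans _ _
    exact congrArg (fun k : X.carrier ⟶ X.carrier => k x) h
  let c : ∀ f : Over X.carrier, f ⟶ i := fun f => Over.homMk f.hom
  have hck : ∀ {f g : Over X.carrier} (k : f ⟶ g), k ≫ c g = c f := fun k =>
    Over.OverMorphism.ext (Over.w k)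
  choose l hl hl' using fun f : Over X.carrier => (atlasMap p (c f)).exists_section hP
    (atlasObj_base p f) (isHomLift_atlasMap p (c f)) (f.hom ≫ σ₀) (fun t => h1' _)
  refine ⟨⟨l, hl, fun f t => ?_, fun {f g} k t => ?_⟩⟩
  · rw [← (atlasMap p (c f)).map_total, hl']
    exact h2' _
  · refine (atlasMap p (c g)).eq_of_total_eq_of_projTo (atlasObj_base p g) ?_ ?_
    · rw [hl, atlasMap_projTo, hl]
    · rw [hl', ← atlasMap_comp_total, hck, hl']
      exact congrArg σ₀ (congrArg (fun m : f.left ⟶ X.carrier => m t) (Over.w k)).symm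

namespace AtlasSections

variable {p : X.carrier.stack ⥤ᵇ quotientStack X} (s : AtlasSections p)

theorem exists_eq_smul (f : Over X.carrier) (e : (atlasObj p f).bundle.carrier) :
    ∃ a, ∃ g : G, e = op g • s.σ f a := by
  refine ⟨(atlasObj p f).projTo (atlasObj_base p f) e,
    ((atlasObj p f).projTo_eq_iff (atlasObj_base p f) _ _).1 ?_⟩
  rw [s.projTo_σ]

theorem hom_ext {f : Over X.carrier} {Q : QuotObj X} {m m' : QuotHom (atlasObj p f) Q}
    (h : ∀ t, m.total (s.σ f t) = m'.total (s.σ f t)) : m = m' := by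
  refine QuotHom.ext_total fun e => ?_
  obtain ⟨a, g, rfl⟩ := s.exists_eq_smul f e
  rw [m.total_smul, m'.total_smul, h]

/-- The section trivialises the source, and freeness leaves no relation among its translates, so its
image may be prescribed at will, subject to compatibility with the maps to `X`. -/
theorem exists_hom (f : Over X.carrier) (Q : QuotObj X) (h : f.left ⟶ Q.bundle.carrier)
    (hh : ∀ t, Q.map (h t) = f.hom t) :
    ∃ m : QuotHom (atlasObj p f) Q, (∀ t, m.total (s.σ f t) = h t) ∧
      m.base = eqToHom (atlasObj_base p f) ≫ h ≫ Q.proj := by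
  let E := atlasObj p f
  have hE : E.base = f.left := atlasObj_base p f
  obtain ⟨m, hm, hmσ⟩ := GMan.exists_equivariant_extension (E := E.bundle) (Y := Q.bundle)
    (j := s.σ f) (E.isEtale_section hE (s.σ f) (s.projTo_σ f)) (s.exists_eq_smul f) h (by
      intro a a' g haa
      have h1 := (E.projTo_eq_iff hE (s.σ f a) (s.σ f a')).2 ⟨g, haa⟩
      rw [s.projTo_σ, s.projTo_σ] at h1
      subst h1
      rw [E.isPrincipalBundle.free _ _ haa.symm, op_one, one_smul])
  refine ⟨⟨eqToHom hE ≫ h ≫ Q.proj, m, hm, ?_, ?_⟩, hmσ, rfl⟩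
  · refine AnMan.hom_ext fun e => ?_
    obtain ⟨a, g, rfl⟩ := s.exists_eq_smul f e
    change Q.proj (m (op g • _)) = Q.proj (h (E.projTo hE _))
    rw [hm, MonoidHom.id_apply, Q.isPrincipalBundle.proj_smul, hmσ,
      ← (E.projTo_eq_iff hE _ _).2 ⟨g, rfl⟩, s.projTo_σ]
  · refine AnMan.hom_ext fun e => ?_
    obtain ⟨a, g, rfl⟩ := s.exists_eq_smul f e
    change Q.map (m (op g • _)) = E.map (op g • _)
    rw [hm, MonoidHom.id_apply, Q.map_equivariant, hmσ, hh, E.map_equivariant, s.map_σ]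

/-- The total space of a bundle is its fibre product with the atlas. -/
theorem exists_universal (s : AtlasSections p) (Q : QuotObj X) : ∃ (B : Over X.carrier)
    (m : QuotHom (atlasObj p B) Q),
    (∀ (B' : Over X.carrier) (m' : p.obj B' ⟶ (Q : (quotientStack X).obj)),
      ∃! b : B' ⟶ B, p.map b ≫ m = m') ∧ IsEtale m.base := by
  -- The universal arrow is the tautological one: pulled back to its own total space, `Q` acquires
  -- the diagonal section, here given by the identity map.
  obtain ⟨m, hm, hmb⟩ := s.exists_hom (Over.mk Q.map) Q (𝟙 _) (fun _ => rfl)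
  refine ⟨Over.mk Q.map, m, fun B' m' => ?_, ?_⟩
  · let b : B' ⟶ Over.mk Q.map := Over.homMk (s.σ B' ≫ (toQuotHom m').total) (by
      refine AnMan.hom_ext fun t => ?_
      exact ((toQuotHom m').map_total _).trans (s.map_σ B' t))
    refine ⟨b, s.hom_ext fun t => ?_, fun b' hb' => Over.OverMorphism.ext (AnMan.hom_ext fun t => ?_)⟩
    · change m.total ((atlasMap p b).total (s.σ B' t)) = _
      rw [s.total_σ, hm]
      rfl
    · have h1 : m.total ((atlasMap p b').total (s.σ B' t)) =
        (toQuotHom m').total (s.σ B' t) :=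
        congrArg (fun k : QuotHom (atlasObj p B') Q => k.total (s.σ B' t)) hb'
      rw [s.total_σ, hm] at h1
      exact h1
  · rw [hmb, Category.id_comp]
    exact Q.isPrincipalBundle.isEtale.comp
      (isEtale_of_iso (eqToHom (atlasObj_base p (Over.mk Q.map)).symm) (eqToHom_trans _ _)
        (eqToHom_trans _ _))

end AtlasSections

theorem isSubmersion_iso_comp {X Y X' Y' : AnMan} (f : X ⟶ Y) (e : X' ≅ X) (e' : Y ≅ Y')
    (h : IsSubmersion f) : IsSubmersion (e.hom ≫ f ≫ e'.hom) := by
  intro x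
  have he := isEtale_of_iso e.inv e.hom_inv_id e.inv_hom_id
  have he' := isEtale_of_iso e'.inv e'.hom_inv_id e'.inv_hom_id
  have h1 : MDifferentiableAt 𝓘(ℂ, X'.E) 𝓘(ℂ, X.E) e.hom x :=
    (e.hom.contMDiff x).mdifferentiableAt (by simp)
  have h2 : MDifferentiableAt 𝓘(ℂ, X.E) 𝓘(ℂ, Y.E) f (e.hom x) :=
    (f.contMDiff _).mdifferentiableAt (by simp)
  have h3 : MDifferentiableAt 𝓘(ℂ, Y.E) 𝓘(ℂ, Y'.E) e'.hom (f (e.hom x)) :=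
    (e'.hom.contMDiff _).mdifferentiableAt (by simp)
  have h4 : mfderiv 𝓘(ℂ, X'.E) 𝓘(ℂ, Y'.E) (e.hom ≫ f ≫ e'.hom) x =
      (mfderiv 𝓘(ℂ, Y.E) 𝓘(ℂ, Y'.E) e'.hom (f (e.hom x))).comp
        ((mfderiv 𝓘(ℂ, X.E) 𝓘(ℂ, Y.E) f (e.hom x)).comp
          (mfderiv 𝓘(ℂ, X'.E) 𝓘(ℂ, X.E) e.hom x)) := by
    rw [← mfderiv_comp x h2 h1]
    exact mfderiv_comp x h3 (h2.comp x h1)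
  rw [h4]
  exact (he'.isSubmersion _).comp ((h _).comp (he.isSubmersion x))

/-- Base change of the atlas to an object is the projection of its bundle, which is étale and so a
submersion. Surjectivity comes from local sections, over whose domains the bundle is trivial. -/
theorem IsCanonicalAtlas.isAnalyticStack [Countable G] {p : X.carrier.stack ⥤ᵇ quotientStack X}
    (hp : IsCanonicalAtlas X p) : IsAnalyticStack (quotientStack X) p := by
  obtain ⟨s⟩ := hp.nonempty_sections
  refine ⟨quotientStack_isStack X, ?_, ?_, ?_⟩
  · refine isRepresentableWith_of_universal (fun _ _ _ _ => trivial)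
      X.carrier.stack_isFibredInGroupoids (quotientStack_isFibredInGroupoids X) p fun Q => ?_
    obtain ⟨B, m, hm, -⟩ := s.exists_universal Q
    exact ⟨B, m, hm, trivial⟩
  · intro (Q : QuotObj X)
    choose a ha using Q.isPrincipalBundle.surjective
    choose V hV l hl using fun x => AnMan.exists_local_section Q.isPrincipalBundle.isEtale (a x)
    refine ⟨Q.base, V, ?_, fun x => ?_⟩
    · refine eq_top_iff.2 fun x _ => Opens.mem_iSup.2 ⟨x, ?_⟩
      have h1 := hV x
      rw [ha x] at h1
      exact h1
    · obtain ⟨m, -, hmb⟩ := s.exists_hom (Over.mk (l x ≫ Q.map)) Q (l x) (fun _ => rfl)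
      refine ⟨Over.mk (l x ≫ Q.map), m, ?_⟩
      have h1 : l x ≫ Q.proj = Q.base.incl (V x) := AnMan.hom_ext (hl x)
      refine CategoryTheory.IsHomLift.of_fac' (quotientStack X).p _ _
        (atlasObj_base p (Over.mk (l x ≫ Q.map))) rfl ?_
      exact hmb.trans (congrArg (eqToHom (atlasObj_base p (Over.mk (l x ≫ Q.map))) ≫ ·)
        (h1.trans (Category.comp_id _).symm))
  · refine isRepresentableWith_of_universal isSubmersion_iso_comp
      X.carrier.stack_isFibredInGroupoids (quotientStack_isFibredInGroupoids X) p fun Q => ?_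
    obtain ⟨B, m, hm, hmb⟩ := s.exists_universal Q
    exact ⟨B, m, hm, hmb.isSubmersion⟩

end Atlas

/-! ## Extension of the structure group from a subgroup -/

section Extension

open AnMan

variable {G : Type} [Group G] (H : Subgroup G)

/-- The discrete space of right cosets of a subgroup. -/
def CosetSpace : Type := Quotient (QuotientGroup.rightRel H)

/-! ### Right cosets and the cocycle of a choice of representatives -/

namespace CosetSpace

instance : TopologicalSpace (CosetSpace H) := ⊥

instance : DiscreteTopology (CosetSpace H) := ⟨rfl⟩

instance [Countable G] : Countable (CosetSpace H) :=
  inferInstanceAs (Countable (Quotient (QuotientGroup.rightRel H)))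

variable {H}

/-- The right coset of an element. -/
def mk (g : G) : CosetSpace H := Quotient.mk _ g

/-- A representative of a right coset. -/
def rep (c : CosetSpace H) : G := Quotient.out c

theorem mk_rep (c : CosetSpace H) : mk c.rep = c := Quotient.out_eq c

theorem mk_eq_iff {a b : G} : (mk a : CosetSpace H) = mk b ↔ b * a⁻¹ ∈ H :=
  Quotient.eq.trans QuotientGroup.rightRel_apply

theorem mk_rep_mul (a g : G) : (mk ((mk a : CosetSpace H).rep * g) : CosetSpace H) = mk (a * g) := by
  rw [mk_eq_iff, mul_inv_rev, mul_assoc, mul_inv_cancel_left, ← mk_eq_iff, mk_rep]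

/-- The element of the subgroup comparing the representatives of `c` and `c · g`. -/
def cocycle (c : CosetSpace H) (g : G) : H :=
  ⟨c.rep * g * (mk (c.rep * g) : CosetSpace H).rep⁻¹, mk_eq_iff.1 (mk_rep _)⟩

theorem cocycle_mul_rep (c : CosetSpace H) (g : G) :
    (c.cocycle g : G) * (mk (c.rep * g) : CosetSpace H).rep = c.rep * g :=
  inv_mul_cancel_right _ _

theorem cocycle_one (c : CosetSpace H) : c.cocycle 1 = 1 := by
  refine Subtype.ext ?_
  rw [← mul_left_inj, cocycle_mul_rep, mul_one, mk_rep, H.coe_one, one_mul]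

/-- Comparing the two ways of moving `a * b` past a representative gives the identity that makes the
twisted action on `ExtSpace` associative. -/
theorem cocycle_mul (c : CosetSpace H) (a b : G) :
    c.cocycle (a * b) = c.cocycle a * (mk (c.rep * a) : CosetSpace H).cocycle b := by
  refine Subtype.ext ?_
  have h := (mk (c.rep * a) : CosetSpace H).cocycle_mul_rep b
  rw [mk_rep_mul, mul_assoc] at h
  rw [← mul_left_inj, cocycle_mul_rep, H.coe_mul, mul_assoc (c.cocycle a : G), h,
    ← mul_assoc (c.cocycle a : G), cocycle_mul_rep, mul_assoc]

/-- The element `c.rep⁻¹ * h * d.rep` moves the coset `c` to `d` with cocycle `h`; together with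
`cocycle_conj` this yields transitivity on the fibres of the extended bundle. -/
theorem mk_rep_mul_conj (c d : CosetSpace H) (h : H) :
    (mk (c.rep * (c.rep⁻¹ * h * d.rep)) : CosetSpace H) = d := by
  conv_rhs => rw [← mk_rep d]
  rw [mk_eq_iff, mul_assoc, mul_inv_cancel_left, mul_inv_rev, mul_inv_cancel_left]
  exact H.inv_mem h.2

theorem cocycle_conj (c d : CosetSpace H) (h : H) :
    c.cocycle (c.rep⁻¹ * h * d.rep) = h := by
  refine Subtype.ext ?_
  have h1 := c.cocycle_mul_rep (c.rep⁻¹ * h * d.rep)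
  rw [mk_rep_mul_conj, mul_assoc c.rep⁻¹, mul_inv_cancel_left, mul_left_inj] at h1
  rwa [mul_assoc c.rep⁻¹]

/-- The inverse of the representative of the trivial coset. -/
def invRepOne : H := ⟨(mk 1 : CosetSpace H).rep⁻¹, by
  have h := mk_eq_iff.1 (mk_rep (mk 1 : CosetSpace H))
  rwa [one_mul] at h⟩

theorem mk_rep_one_mul (h : H) : (mk ((mk 1 : CosetSpace H).rep * h) : CosetSpace H) = mk 1 := by
  rw [mk_rep_mul, mk_eq_iff, one_mul, one_mul]
  exact H.inv_mem h.2

/-- The representative of the trivial coset need not be `1`, so the map from a bundle to its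
extension is corrected by `invRepOne`; this identity is what makes the corrected map equivariant. -/
theorem invRepOne_mul_cocycle (h : H) :
    invRepOne * (mk 1 : CosetSpace H).cocycle h = h * invRepOne := by
  refine Subtype.ext ?_
  have h1 := (mk 1 : CosetSpace H).cocycle_mul_rep h
  rw [mk_rep_one_mul, ← eq_mul_inv_iff_mul_eq] at h1
  rw [H.coe_mul, h1, H.coe_mul, mul_assoc]
  exact inv_mul_cancel_left _ _

end CosetSpace

variable {H} {Y : GMan H} {X : GMan G}

/-- The total space of the bundle obtained from an `H`-bundle by extension of the structure
group. -/
def ExtSpace (P : QuotObj Y) : Type := P.bundle.carrier × CosetSpace H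

/-! ### The bundle `P ×_H G` modelled on `P × (H \ G)` -/

namespace ExtSpace

variable (P : QuotObj Y)

instance : TopologicalSpace (ExtSpace P) :=
  inferInstanceAs (TopologicalSpace (P.bundle.carrier × CosetSpace H))

instance : T2Space (ExtSpace P) := inferInstanceAs (T2Space (P.bundle.carrier × CosetSpace H))

instance [Countable G] : SecondCountableTopology (ExtSpace P) :=
  inferInstanceAs (SecondCountableTopology (P.bundle.carrier × CosetSpace H))

/-- The pair `(p, c)` stands for the class of `(p, c.rep)`. Since `c.rep * g` is the cocycle times
the new representative, the cocycle is absorbed by `p`. -/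
instance : MulAction Gᵐᵒᵖ (ExtSpace P) where
  smul g x := (op (x.2.cocycle g.unop) • x.1, .mk (x.2.rep * g.unop))
  one_smul x := Prod.ext (by
    change op (x.2.cocycle 1) • x.1 = x.1
    rw [CosetSpace.cocycle_one, op_one, one_smul]) (by
    change CosetSpace.mk (x.2.rep * 1) = x.2
    rw [mul_one, CosetSpace.mk_rep])
  mul_smul g h x := Prod.ext (by
    change op (x.2.cocycle (h.unop * g.unop)) • x.1 =
      op (CosetSpace.cocycle (.mk (x.2.rep * h.unop)) g.unop) • op (x.2.cocycle h.unop) • x.1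
    rw [CosetSpace.cocycle_mul, op_mul, mul_smul]) (by
    change CosetSpace.mk (x.2.rep * (h.unop * g.unop)) =
      CosetSpace.mk ((CosetSpace.mk (x.2.rep * h.unop) : CosetSpace H).rep * g.unop)
    rw [CosetSpace.mk_rep_mul, mul_assoc])

theorem continuous_fst : Continuous fun x : ExtSpace P => x.1 := _root_.continuous_fst

theorem isOpen_snd (c : CosetSpace H) : IsOpen {x : ExtSpace P | x.2 = c} :=
  (isOpen_discrete {c}).preimage _root_.continuous_snd

theorem isLocalHomeomorph : IsLocalHomeomorph fun x : ExtSpace P => P.proj x.1 := by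
  have hπ := P.isPrincipalBundle.isLocalDiffeomorph.isLocalHomeomorph
  refine isLocalHomeomorph_of_isOpenMap (P.proj.continuous.comp (continuous_fst P))
    (hπ.isOpenMap.comp isOpenMap_fst) fun x => ?_
  obtain ⟨e, he, hπe⟩ := hπ x.1
  refine ⟨_, (e.open_source.preimage (continuous_fst P)).inter (isOpen_snd P x.2), ⟨he, rfl⟩,
    fun y hy z hz hyz => Prod.ext (e.injOn hy.1 hz.1 ?_) (hy.2.trans hz.2.symm)⟩
  rw [← hπe]
  exact hyz

theorem continuous_smul (g : G) : Continuous fun x : ExtSpace P => op g • x :=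
  (continuous_prod_of_discrete_right (α := P.bundle.carrier) (β := CosetSpace H)).2 fun c =>
    ((P.bundle.act (c.cocycle g)).continuous).prodMk
      (continuous_const (y := (CosetSpace.mk (c.rep * g) : CosetSpace H)))

variable [Countable G]

/-- The total space of the extension, as a manifold with group action. -/
def toGMan : GMan G :=
  etaleGMan P.base (ExtSpace P) (isLocalHomeomorph P) (continuous_smul P)
    (fun _ _ => P.isPrincipalBundle.proj_smul _ _)

/-- The projection of the extension to the base. -/
def proj : (toGMan P).carrier ⟶ P.base := etaleProj P.base (ExtSpace P) (isLocalHomeomorph P)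

theorem isPrincipalBundle : IsPrincipalBundle (toGMan P) (proj P) where
  surjective t := by
    obtain ⟨p, hp⟩ := P.isPrincipalBundle.surjective t
    exact ⟨((p, .mk 1) : ExtSpace P), hp⟩
  isLocalDiffeomorph := isEtale_etaleSpace P.base _ _
  fibre (x : ExtSpace P) (y : ExtSpace P) := by
    constructor
    · intro h
      obtain ⟨h, hh⟩ := (P.isPrincipalBundle.fibre x.1 y.1).1 h
      exact ⟨x.2.rep⁻¹ * h * y.2.rep, Prod.ext
        (hh.trans (congrArg (fun k : H => op k • x.1) (x.2.cocycle_conj y.2 h)).symm)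
        (x.2.mk_rep_mul_conj y.2 h).symm⟩
    · rintro ⟨g, rfl⟩
      exact (P.isPrincipalBundle.proj_smul _ _).symm
  free (x : ExtSpace P) g h := by
    have h1 : op (x.2.cocycle g) • x.1 = x.1 := congrArg (fun x : ExtSpace P => x.1) h
    have h2 : CosetSpace.mk (x.2.rep * g) = x.2 := congrArg (fun x : ExtSpace P => x.2) h
    have h3 := x.2.cocycle_mul_rep g
    rw [P.isPrincipalBundle.free _ _ h1, h2, H.coe_one, one_mul] at h3
    exact left_eq_mul.1 h3

/-- The projection of the extension to the original bundle. -/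
def fst : (toGMan P).carrier ⟶ P.bundle.carrier :=
  ⟨fun x : ExtSpace P => x.1, IsEtale.contMDiff_of_comp_eq P.isPrincipalBundle.isEtale
    (continuous_fst P) (proj P) (fun _ => rfl)⟩

/-- The map to `X` induced by an equivariant map `Y ⟶ X`. -/
def map (f : Y.carrier ⟶ X.carrier) : (toGMan P).carrier ⟶ X.carrier :=
  ⟨fun x : ExtSpace P => op x.2.rep • f (P.map x.1), fun x => by
    let x' : ExtSpace P := x
    refine ContMDiffAt.congr_of_eventuallyEq
      ((fst P ≫ P.map ≫ f ≫ X.act x'.2.rep).contMDiff x) ?_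
    -- The coset is locally constant, so near `x` the map is a composite with one fixed group
    -- element.
    filter_upwards [(isOpen_snd P x'.2).mem_nhds rfl] with y hy
    exact congrArg (fun c : CosetSpace H => op c.rep • f (P.map (ExtSpace.fst P y))) hy⟩

end ExtSpace

variable [Countable G]

/-- The extension of the structure group of an object of the quotient stack. -/
def QuotObj.extend (f : Y.carrier ⟶ X.carrier) (hf : IsEquivariant H.subtype Y X f)
    (P : QuotObj Y) : QuotObj X where
  base := P.base
  bundle := ExtSpace.toGMan P
  proj := ExtSpace.proj P
  isPrincipalBundle := ExtSpace.isPrincipalBundle P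
  map := ExtSpace.map P f
  map_equivariant g (x : ExtSpace P) := by
    change op (CosetSpace.rep (.mk (x.2.rep * g))) • f (P.map (op (x.2.cocycle g) • x.1)) =
      op g • op x.2.rep • f (P.map x.1)
    rw [P.map_equivariant, hf, smul_smul, smul_smul, ← op_mul, ← op_mul]
    exact congrArg (fun a : G => op a • f (P.map x.1)) (x.2.cocycle_mul_rep g)

/-- The morphism induced by a morphism after extension of the structure group. -/
def QuotHom.extend (f : Y.carrier ⟶ X.carrier) (hf : IsEquivariant H.subtype Y X f)
    {P Q : QuotObj Y} (m : QuotHom P Q) : QuotHom (P.extend f hf) (Q.extend f hf) where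
  base := m.base
  total := ⟨fun x : ExtSpace P => ((m.total x.1, x.2) : ExtSpace Q),
    IsEtale.contMDiff_of_comp_eq (X := (ExtSpace.toGMan P).carrier)
      (Y := (ExtSpace.toGMan Q).carrier) (ExtSpace.isPrincipalBundle Q).isEtale
      (Continuous.prodMk (m.total.continuous.comp (ExtSpace.continuous_fst P)) continuous_snd)
      (ExtSpace.proj P ≫ m.base) (fun x : ExtSpace P => m.proj_total x.1)⟩
  equivariant g (x : ExtSpace P) := Prod.ext (m.equivariant (x.2.cocycle g) x.1) rfl
  proj_comm := AnMan.hom_ext fun x : ExtSpace P => m.proj_total x.1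
  map_comm := AnMan.hom_ext fun x : ExtSpace P =>
    congrArg (fun y => op x.2.rep • f y) (m.map_total x.1)

/-- Extension of the structure group, as a morphism of quotient stacks. -/
def extensionFunctor (f : Y.carrier ⟶ X.carrier) (hf : IsEquivariant H.subtype Y X f) :
    quotientStack Y ⥤ᵇ quotientStack X where
  obj P := QuotObj.extend f hf P
  map m := QuotHom.extend f hf m
  map_id _ := QuotHom.ext_total fun _ => rfl
  map_comp _ _ := QuotHom.ext_total fun _ => rfl
  w := rfl

/-- The canonical map from a bundle to its extension. -/
def QuotObj.toExtend (f : Y.carrier ⟶ X.carrier) (hf : IsEquivariant H.subtype Y X f)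
    (P : QuotObj Y) : P.bundle.carrier ⟶ (P.extend f hf).bundle.carrier :=
  ⟨fun p => ((op CosetSpace.invRepOne • p, .mk 1) : ExtSpace P),
    IsEtale.contMDiff_of_comp_eq (Y := (ExtSpace.toGMan P).carrier)
      (ExtSpace.isPrincipalBundle P).isEtale
      (Continuous.prodMk (P.bundle.act CosetSpace.invRepOne).continuous continuous_const) P.proj
      (P.isPrincipalBundle.proj_smul CosetSpace.invRepOne)⟩

theorem isExtensionOfStructureGroup_extensionFunctor (f : Y.carrier ⟶ X.carrier)
    (hf : IsEquivariant H.subtype Y X f) :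
    IsExtensionOfStructureGroup H.subtype f (extensionFunctor f hf) := by
  refine ⟨fun P => QuotObj.toExtend f hf P, fun (P : QuotObj Y) h p => ?_,
    fun (P : QuotObj Y) => AnMan.hom_ext fun p => P.isPrincipalBundle.proj_smul _ p,
    fun (P : QuotObj Y) => AnMan.hom_ext fun p => ?_,
    fun (P : QuotObj Y) (Q : QuotObj Y) (m : QuotHom P Q) => AnMan.hom_ext fun p =>
      Prod.ext (m.total_smul _ p) rfl⟩
  · refine Prod.ext ?_ (CosetSpace.mk_rep_one_mul h).symm
    change op CosetSpace.invRepOne • op h • p =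
      op ((CosetSpace.mk 1 : CosetSpace H).cocycle h) • op CosetSpace.invRepOne • p
    rw [smul_smul, smul_smul, ← op_mul, ← op_mul, CosetSpace.invRepOne_mul_cocycle]
  · change op (CosetSpace.mk 1 : CosetSpace H).rep • f (P.map (op CosetSpace.invRepOne • p)) =
      f (P.map p)
    rw [P.map_equivariant, hf, smul_smul, ← op_mul]
    have h1 : (H.subtype CosetSpace.invRepOne) * (CosetSpace.mk 1 : CosetSpace H).rep = 1 :=
      inv_mul_cancel _
    exact (congrArg (fun a : G => op a • f (P.map p)) h1).trans (one_smul _ _)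

/-! ### Existence of the canonical atlas -/

/-- A manifold with the action of the trivial subgroup. -/
def trivialGMan (G : Type) [Group G] (S : AnMan) : GMan (⊥ : Subgroup G) where
  carrier := S
  mulAction :=
    { smul := fun _ x => x
      one_smul := fun _ => rfl
      mul_smul := fun _ _ _ => rfl }
  contMDiff_act _ := contMDiff_id

theorem isPrincipalBundle_trivialGMan (G : Type) [Group G] (S : AnMan) :
    IsPrincipalBundle (trivialGMan G S) (𝟙 S : S ⟶ S) where
  surjective t := ⟨t, rfl⟩
  isLocalDiffeomorph := isEtale_of_iso (𝟙 S) (Category.comp_id _) (Category.comp_id _)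
  fibre _ _ := ⟨fun h => ⟨1, h.symm⟩, fun ⟨_, h⟩ => h.symm⟩
  free _ _ _ := Subsingleton.elim _ _

/-- A manifold as its quotient by the trivial subgroup. -/
def trivialFunctor (G : Type) [Group G] (S : AnMan) :
    S.stack ⥤ᵇ quotientStack (trivialGMan G S) where
  obj (f : Over S) := (⟨f.left, trivialGMan G f.left, 𝟙 _, isPrincipalBundle_trivialGMan G _, f.hom,
    fun _ _ => rfl⟩ : QuotObj (trivialGMan G S))
  map {f g : Over S} (k : f ⟶ g) := ⟨k.left, k.left, fun _ _ => rfl, rfl, Over.w k⟩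
  map_id _ := rfl
  map_comp _ _ := rfl
  w := rfl

/-- A manifold is its own principal bundle under the trivial group. Extension of structure group to
`G` makes it the trivial `G`-bundle, and the canonical map into the extension is the required
section. -/
theorem exists_isCanonicalAtlas (X : GMan G) :
    ∃ p : X.carrier.stack ⥤ᵇ quotientStack X, IsCanonicalAtlas X p := by
  have hf : IsEquivariant (⊥ : Subgroup G).subtype (trivialGMan G X.carrier) X (𝟙 X.carrier) := by
    intro h x
    obtain rfl : h = 1 := Subsingleton.elim _ _
    exact (one_smul Gᵐᵒᵖ (show X.carrier from x)).symm
  obtain ⟨j, -, h1, h2, -⟩ := isExtensionOfStructureGroup_extensionFunctor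
    (Y := trivialGMan G X.carrier) (X := X) (𝟙 X.carrier) hf
  let P := (trivialFunctor G X.carrier).obj (Over.mk (𝟙 X.carrier))
  refine ⟨(trivialFunctor G X.carrier).comp (extensionFunctor (𝟙 X.carrier) hf), j P, ?_, ?_⟩
  · exact h1 P
  · exact h2 P

end Extension

/-! ## Morphisms of quotient stacks defined by extension of the structure group -/

section ExtensionAnalysis

open AnMan

variable {G : Type} [Group G] {H : Subgroup G} {Y : GMan H} {X : GMan G}

theorem QuotObj.eqToHom_projTo {A : QuotObj X} {T : AnMan} (hA : A.base = T)
    (e : A.bundle.carrier) : eqToHom hA.symm (A.projTo hA e) = A.proj e := by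
  subst hA
  rfl

section ExtObj

variable (F : quotientStack Y ⥤ᵇ quotientStack X)

/-- The bundle given by a morphism of quotient stacks. -/
def extObj (P : QuotObj Y) : QuotObj X := F.obj P

/-- The bundle map given by a morphism of quotient stacks. -/
def extMap {P Q : QuotObj Y} (m : QuotHom P Q) : QuotHom (extObj F P) (extObj F Q) := F.map m

theorem extObj_base (P : QuotObj Y) : (extObj F P).base = P.base := F.w_obj P

end ExtObj

/-- Compatible maps from bundles to their images under a morphism of quotient stacks. -/
structure ExtensionMaps (f : Y.carrier ⟶ X.carrier) (F : quotientStack Y ⥤ᵇ quotientStack X) where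
  j : ∀ P : QuotObj Y, P.bundle.carrier ⟶ (extObj F P).bundle.carrier
  j_smul : ∀ P (h : H) (p : P.bundle.carrier), j P (op h • p) = op (h : G) • j P p
  projTo_j : ∀ P p, (extObj F P).projTo (extObj_base F P) (j P p) = P.proj p
  map_j : ∀ P p, (extObj F P).map (j P p) = f (P.map p)
  total_j : ∀ {P Q : QuotObj Y} (m : QuotHom P Q) (p : P.bundle.carrier),
    (extMap F m).total (j P p) = j Q (m.total p)

theorem IsExtensionOfStructureGroup.nonempty_maps {f : Y.carrier ⟶ X.carrier}
    {F : quotientStack Y ⥤ᵇ quotientStack X}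
    (hF : IsExtensionOfStructureGroup H.subtype f F) : Nonempty (ExtensionMaps f F) := by
  obtain ⟨j, h1, h2, h3, h4⟩ := hF
  exact ⟨⟨j, h1,
    fun P p => congrArg (fun k : P.bundle.carrier ⟶ P.base => k p) (h2 P),
    fun P p => congrArg (fun k : P.bundle.carrier ⟶ X.carrier => k p) (h3 P),
    fun {P Q} m p =>
      congrArg (fun k : P.bundle.carrier ⟶ (extObj F Q).bundle.carrier => k p) (h4 P Q m)⟩⟩

namespace ExtensionMaps

variable {f : Y.carrier ⟶ X.carrier} {F : quotientStack Y ⥤ᵇ quotientStack X}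
  (s : ExtensionMaps f F)

theorem isEtale_j (P : QuotObj Y) : IsEtale (s.j P) := fun p =>
  EtaleAt.of_comp_left ((extObj F P).isEtale_projTo (extObj_base F P) _)
    (s.j P).continuous.continuousAt (by
      rw [show ((extObj F P).projTo (extObj_base F P) : (extObj F P).bundle.carrier → P.base) ∘
        s.j P = P.proj from funext (s.projTo_j P)]
      exact P.isPrincipalBundle.isEtale p)

theorem exists_eq_smul (P : QuotObj Y) (e : (extObj F P).bundle.carrier) :
    ∃ a, ∃ g : G, e = op g • s.j P a := by
  obtain ⟨a, ha⟩ := P.isPrincipalBundle.surjective ((extObj F P).projTo (extObj_base F P) e)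
  refine ⟨a, ((extObj F P).projTo_eq_iff (extObj_base F P) _ _).1 ?_⟩
  rw [s.projTo_j, ha]

theorem hom_ext {P : QuotObj Y} {Q : QuotObj X} {m m' : QuotHom (extObj F P) Q}
    (h : ∀ p, m.total (s.j P p) = m'.total (s.j P p)) : m = m' := by
  refine QuotHom.ext_total fun e => ?_
  obtain ⟨a, g, rfl⟩ := s.exists_eq_smul P e
  rw [m.total_smul, m'.total_smul, h]

/-- The universal property of `P ×_H G`. Translates of the image of `P` exhaust it, and a relation
between image points lies in one fibre, so it comes from `H` by freeness; equivariance of `h` under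
`H` therefore suffices. -/
theorem exists_hom (P : QuotObj Y) (Q : QuotObj X) (h : P.bundle.carrier ⟶ Q.bundle.carrier)
    (hh : ∀ (k : H) p, h (op k • p) = op (k : G) • h p)
    (hm : ∀ p, Q.map (h p) = f (P.map p)) (b : P.base ⟶ Q.base)
    (hb : ∀ p, Q.proj (h p) = b (P.proj p)) :
    ∃ m : QuotHom (extObj F P) Q, (∀ p, m.total (s.j P p) = h p) ∧
      m.base = eqToHom (extObj_base F P) ≫ b := by
  let E := extObj F P
  have hE : E.base = P.base := extObj_base F P
  obtain ⟨m, hme, hmj⟩ := GMan.exists_equivariant_extension (E := E.bundle) (Y := Q.bundle)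
    (s.isEtale_j P) (s.exists_eq_smul P) h (by
      intro a a' g haa
      have h1 := (E.projTo_eq_iff hE (s.j P a) (s.j P a')).2 ⟨g, haa⟩
      rw [s.projTo_j, s.projTo_j] at h1
      obtain ⟨k, rfl⟩ := (P.isPrincipalBundle.fibre _ _).1 h1
      rw [s.j_smul] at haa
      rw [hh, E.isPrincipalBundle.eq_of_smul_eq haa])
  refine ⟨⟨eqToHom hE ≫ b, m, hme, ?_, ?_⟩, hmj, rfl⟩
  · refine AnMan.hom_ext fun e => ?_
    obtain ⟨a, g, rfl⟩ := s.exists_eq_smul P e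
    change Q.proj (m (op g • _)) = b (E.projTo hE _)
    rw [hme, MonoidHom.id_apply, Q.isPrincipalBundle.proj_smul, hmj,
      ← (E.projTo_eq_iff hE _ _).2 ⟨g, rfl⟩, s.projTo_j, hb]
  · refine AnMan.hom_ext fun e => ?_
    obtain ⟨a, g, rfl⟩ := s.exists_eq_smul P e
    change Q.map (m (op g • _)) = E.map (op g • _)
    rw [hme, MonoidHom.id_apply, Q.map_equivariant, hmj, hm, E.map_equivariant, s.map_j]

end ExtensionMaps

/-! ### Restriction to a slice -/

theorem isEquivariant_incl (X : GMan G) (H : Subgroup G) (U : Opens X.carrier)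
    (hU : ∀ g ∈ H, ∀ x ∈ U, op g • x ∈ U) :
    IsEquivariant H.subtype (X.restrict H U hU) X (X.carrier.incl U) := fun _ _ => rfl

section Slice

variable {U : Opens X.carrier} (hU : ∀ g ∈ H, ∀ x ∈ U, op g • x ∈ U)
  (hdisj : ∀ g ∉ H, ∀ x ∈ U, op g • x ∉ U) (Q : QuotObj X)

/-- The part of a bundle lying over an open subset of `X`. -/
def QuotObj.over (U : Opens X.carrier) : Opens Q.bundle.carrier :=
  ⟨Q.map ⁻¹' U, U.isOpen.preimage Q.map.continuous⟩

theorem QuotObj.smul_mem_over (hU : ∀ g ∈ H, ∀ x ∈ U, op g • x ∈ U) (g : G) (hg : g ∈ H)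
    (q : Q.bundle.carrier) (hq : q ∈ Q.over U) : op g • q ∈ Q.over U := by
  change Q.map (op g • q) ∈ U
  rw [Q.map_equivariant]
  exact hU g hg _ hq

/-- The image in the base of the part of a bundle lying over an open subset of `X`. -/
def QuotObj.overBase (U : Opens X.carrier) : Opens Q.base :=
  ⟨Q.proj '' Q.over U,
    Q.isPrincipalBundle.isLocalDiffeomorph.isLocalHomeomorph.isOpenMap _ (Q.over U).isOpen⟩

/-- The projection of the part of a bundle lying over an open subset of `X`. -/
def QuotObj.overProj (U : Opens X.carrier) :
    Q.bundle.carrier.restrict (Q.over U) ⟶ Q.base.restrict (Q.overBase U) :=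
  liftOpen (Q.bundle.carrier.incl (Q.over U) ≫ Q.proj) (Q.overBase U) fun q => ⟨q.1, q.2, rfl⟩

-- If `q` and `q · g` both lie over `U`, disjointness forces `g ∈ H`; thus the part of a fibre over
-- `U` is a single `H`-orbit or empty.
include hdisj in
theorem QuotObj.isPrincipalBundle_over :
    IsPrincipalBundle (Q.bundle.restrict H (Q.over U) (Q.smul_mem_over hU)) (Q.overProj U) where
  surjective := by
    rintro ⟨_, q, hq, rfl⟩
    exact ⟨⟨q, hq⟩, rfl⟩
  isLocalDiffeomorph q :=
    EtaleAt.of_comp_left (isEtale_incl (Q.overBase U) _) (Q.overProj U).continuous.continuousAt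
      (Q.isPrincipalBundle.isEtale.comp (isEtale_incl (Q.over U)) q)
  fibre p q := by
    constructor
    · intro h
      obtain ⟨g, hg⟩ := (Q.isPrincipalBundle.fibre p.1 q.1).1 (congrArg Subtype.val h)
      refine ⟨⟨g, ?_⟩, Subtype.ext hg⟩
      by_contra hgH
      refine hdisj g hgH (Q.map p.1) p.2 ?_
      have h1 := Q.map_equivariant g p.1
      rw [← hg] at h1
      exact Set.mem_of_eq_of_mem h1.symm q.2
    · rintro ⟨g, rfl⟩
      exact Subtype.ext (Q.isPrincipalBundle.proj_smul (g : G) p.1).symm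
  free p g h := Subtype.ext (Q.isPrincipalBundle.free p.1 g (congrArg Subtype.val h))

/-- The part of an object of `[X/G]` lying over a slice, as an object of `[U/H]`. -/
def QuotObj.slice : QuotObj (X.restrict H U hU) where
  base := Q.base.restrict (Q.overBase U)
  bundle := Q.bundle.restrict H (Q.over U) (Q.smul_mem_over hU)
  proj := Q.overProj U
  isPrincipalBundle := Q.isPrincipalBundle_over hU hdisj
  map := liftOpen (Q.bundle.carrier.incl (Q.over U) ≫ Q.map) U fun q => q.2
  map_equivariant g q := Subtype.ext (Q.map_equivariant (g : G) q.1)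

variable {F : quotientStack (X.restrict H U hU) ⥤ᵇ quotientStack X}

theorem ExtensionMaps.exists_slice_hom (s : ExtensionMaps (X.carrier.incl U) F) :
    ∃ m : QuotHom (extObj F (Q.slice hU hdisj)) Q,
      (∀ p, m.total (s.j _ p) = Q.bundle.carrier.incl (Q.over U) p) ∧
      m.base = eqToHom (extObj_base F (Q.slice hU hdisj)) ≫ Q.base.incl (Q.overBase U) :=
  s.exists_hom (Q.slice hU hdisj) Q (Q.bundle.carrier.incl (Q.over U)) (fun _ _ => rfl)
    (fun _ => rfl) (Q.base.incl (Q.overBase U)) (fun _ => rfl)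

theorem ExtensionMaps.map_total_j_mem (s : ExtensionMaps (X.carrier.incl U) F)
    {B : QuotObj (X.restrict H U hU)} {Q : QuotObj X} (m : QuotHom (extObj F B) Q)
    (p : B.bundle.carrier) : m.total (s.j B p) ∈ Q.over U := by
  change Q.map _ ∈ U
  rw [m.map_total, s.map_j]
  exact (B.map p).2

/-- Compatibility with the maps to `X` forces `m' ∘ j` to land over `U`, so it factors through the
slice, on total spaces and on bases. The factorisation is unique because the slice is a subset of
the total space of `Q`. -/
theorem ExtensionMaps.exists_universal (s : ExtensionMaps (X.carrier.incl U) F)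
    {m : QuotHom (extObj F (Q.slice hU hdisj)) Q}
    (hm : ∀ p, m.total (s.j _ p) = Q.bundle.carrier.incl (Q.over U) p)
    (B : QuotObj (X.restrict H U hU)) (m' : QuotHom (extObj F B) Q) :
    ∃! b : QuotHom B (Q.slice hU hdisj), F.map b ≫ m = m' := by
  have hproj : ∀ p, Q.proj (m'.total (s.j B p)) =
      m'.base (eqToHom (extObj_base F B).symm (B.proj p)) := fun p => by
    rw [m'.proj_total, ← s.projTo_j, QuotObj.eqToHom_projTo]
  have hbase : ∀ t, m'.base (eqToHom (extObj_base F B).symm t) ∈ Q.overBase U := fun t => by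
    obtain ⟨p, rfl⟩ := B.isPrincipalBundle.surjective t
    exact ⟨_, s.map_total_j_mem hU m' p, hproj p⟩
  let b : QuotHom B (Q.slice hU hdisj) :=
    { base := liftOpen (eqToHom (extObj_base F B).symm ≫ m'.base) (Q.overBase U) hbase
      total := liftOpen (s.j B ≫ m'.total) (Q.over U) (s.map_total_j_mem hU m')
      equivariant := fun h p => Subtype.ext (by
        change m'.total (s.j B (op h • p)) = op (h : G) • m'.total (s.j B p)
        rw [s.j_smul, m'.total_smul])
      proj_comm := AnMan.hom_ext fun p => Subtype.ext (hproj p)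
      map_comm := AnMan.hom_ext fun p => Subtype.ext (by
        change Q.map (m'.total (s.j B p)) = X.carrier.incl U (B.map p)
        rw [m'.map_total, s.map_j]) }
  refine ⟨b, s.hom_ext fun p => ?_, fun b' hb' => QuotHom.ext_total fun p => Subtype.ext ?_⟩
  · change m.total ((extMap F b).total (s.j B p)) = _
    rw [s.total_j, hm]
    rfl
  · have h1 : m.total ((extMap F b').total (s.j B p)) = m'.total (s.j B p) :=
      congrArg (fun k : QuotHom (extObj F B) Q => k.total (s.j B p)) hb'
    rw [s.total_j, hm] at h1
    exact h1

theorem isOpenMorphism_iso_comp {X Y X' Y' : AnMan} (f : X ⟶ Y) (e : X' ≅ X) (e' : Y ≅ Y')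
    (h : IsOpenMorphism f) : IsOpenMorphism (e.hom ≫ f ≫ e'.hom) := by
  have he := isEtale_of_iso e.inv e.hom_inv_id e.inv_hom_id
  have he' := isEtale_of_iso e'.inv e'.hom_inv_id e'.inv_hom_id
  exact he'.isLocalHomeomorph.isOpenMap.comp (h.comp he.isLocalHomeomorph.isOpenMap)

include hdisj in
theorem IsExtensionOfStructureGroup.isOpenSubstack [Countable G]
    (hF : IsExtensionOfStructureGroup H.subtype (X.carrier.incl U) F) : IsOpenSubstack F := by
  obtain ⟨s⟩ := hF.nonempty_maps
  have hY := quotientStack_isFibredInGroupoids (X.restrict H U hU)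
  refine ⟨quotientStack_isStack _, ?_, ?_⟩
  · refine isRepresentableWith_of_universal (fun _ _ _ _ => trivial) hY
      (quotientStack_isFibredInGroupoids X) F fun (Q : QuotObj X) => ?_
    obtain ⟨m, hm, -⟩ := s.exists_slice_hom hU hdisj Q
    exact ⟨Q.slice hU hdisj, m, s.exists_universal hU hdisj Q hm, trivial⟩
  · refine isRepresentableWith_of_universal isOpenMorphism_iso_comp hY
      (quotientStack_isFibredInGroupoids X) F fun (Q : QuotObj X) => ?_
    obtain ⟨m, hm, hmb⟩ := s.exists_slice_hom hU hdisj Q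
    refine ⟨Q.slice hU hdisj, m, s.exists_universal hU hdisj Q hm, ?_⟩
    change IsOpenMap m.base
    rw [hmb]
    exact (isEtale_incl (Q.overBase U)).isLocalHomeomorph.isOpenMap.comp
      (isEtale_of_iso (eqToHom (extObj_base F (Q.slice hU hdisj)).symm) (eqToHom_trans _ _)
        (eqToHom_trans _ _)).isLocalHomeomorph.isOpenMap

end Slice

/-- A family of slices through all points defines an orbifold structure. -/
theorem GMan.isAnalyticOrbifold [Countable G] (X : GMan G)
    {p : X.carrier.stack ⥤ᵇ quotientStack X} (hp : IsCanonicalAtlas X p)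
    (hfin : ∀ x, Finite (X.stabiliser x)) (U : X.carrier → Opens X.carrier)
    (hU : ∀ x, X.IsSlice x (U x))
    (F : ∀ x, quotientStack (X.restrict (X.stabiliser x) (U x) (hU x).invariant) ⥤ᵇ
      quotientStack X)
    (hF : ∀ x, IsExtensionOfStructureGroup (X.stabiliser x).subtype (X.carrier.incl (U x)) (F x)) :
    IsAnalyticOrbifold (quotientStack X) p
      (fun x => X.restrict (X.stabiliser x) (U x) (hU x).invariant) F := by
  refine ⟨hp.isAnalyticStack, hfin,
    fun x => (hF x).isOpenSubstack (hU x).invariant (hU x).disjoint, fun (Q : QuotObj X) => ?_⟩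
  -- The cover is indexed by the points of the total space: `q` lies over the slice at its own
  -- image, so its projection lies in the corresponding open subset.
  refine ⟨Q.bundle.carrier, fun q => Q.overBase (U (Q.map q)), ?_, fun q => ?_⟩
  · refine eq_top_iff.2 fun t _ => ?_
    obtain ⟨q, rfl⟩ := Q.isPrincipalBundle.surjective t
    exact Opens.mem_iSup.2 ⟨q, q, (hU (Q.map q)).mem, rfl⟩
  · let x := Q.map q
    obtain ⟨s⟩ := (hF x).nonempty_maps
    obtain ⟨m, -, hmb⟩ := s.exists_slice_hom (hU x).invariant (hU x).disjoint Q
    refine ⟨⟨x, Q.slice (hU x).invariant (hU x).disjoint⟩, m, ?_⟩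
    refine CategoryTheory.IsHomLift.of_fac' (quotientStack X).p _ _
      (extObj_base (F x) (Q.slice (hU x).invariant (hU x).disjoint)) rfl ?_
    exact hmb.trans (congrArg (CategoryStruct.comp (eqToHom _)) (Category.comp_id _).symm)

end ExtensionAnalysis

/-! ## Slices for proper actions -/

namespace GMan

variable {G : Type} [Group G] (X : GMan G)

theorem mem_stabiliser {x : X.carrier} {g : G} : g ∈ X.stabiliser x ↔ op g • x = x := Iff.rfl

variable (hX : ∀ C : Set X.carrier, IsCompact C → {g : G | ∃ z ∈ C, op g • z ∈ C}.Finite)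

include hX

/-- Stabilisers of a proper action are finite. -/
theorem finite_stabiliser (x : X.carrier) : Finite (X.stabiliser x) :=
  ((hX {x} isCompact_singleton).subset fun _ hg => ⟨x, rfl, hg⟩ : (X.stabiliser x : Set G).Finite)

/-- A proper action has slices. -/
theorem exists_isSlice (x : X.carrier) : ∃ U, X.IsSlice x U := by
  have hc : ∀ g : G, Continuous fun y : X.carrier => op g • y := fun g => (X.act g).continuous
  have := ChartedSpace.locallyCompactSpace X.carrier.E X.carrier
  obtain ⟨K, hK, hxK⟩ := exists_compact_mem_nhds x
  have hT := hX K hK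
  have hN : ∀ g ∉ X.stabiliser x, ∃ N : Set X.carrier, IsOpen N ∧ x ∈ N ∧
      ∀ y ∈ N, op g • y ∉ N := by
    intro g hg
    obtain ⟨A, B, hA, hB, hxA, hxB, hAB⟩ := t2_separation hg
    exact ⟨B ∩ (op g • ·) ⁻¹' A, hB.inter (hA.preimage (hc g)), ⟨hxB, hxA⟩,
      fun y hy hy' => Set.disjoint_left.1 hAB hy.2 hy'.1⟩
  choose! N hNo hxN hNd using hN
  -- Inside `K` only the finitely many `g` with `K · g` meeting `K` can violate disjointness; those
  -- outside the stabiliser are excluded by intersecting with `N g`.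
  let W : Set X.carrier :=
    interior K ∩ ⋂ g ∈ {g : G | ∃ z ∈ K, op g • z ∈ K} \ X.stabiliser x, N g
  have hW : IsOpen W := isOpen_interior.inter (hT.sdiff.isOpen_biInter fun g hg => hNo g hg.2)
  have hxW : x ∈ W := ⟨mem_interior_iff_mem_nhds.2 hxK, Set.mem_iInter₂.2 fun g hg => hxN g hg.2⟩
  have := X.finite_stabiliser hX x
  -- Intersecting over the finite stabiliser makes the neighbourhood invariant while keeping it open
  -- and inside `W`.
  refine ⟨⟨⋂ h : X.stabiliser x, (op (h : G) • ·) ⁻¹' W,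
    isOpen_iInter_of_finite fun h => hW.preimage (hc h)⟩, ?_, fun g hg y hy => ?_,
    fun g hg y hy hy' => ?_⟩
  · refine Set.mem_iInter.2 fun h => ?_
    change op (h : G) • x ∈ W
    rwa [X.mem_stabiliser.1 h.2]
  · refine Set.mem_iInter.2 fun h => ?_
    have := Set.mem_iInter.1 hy (⟨g, hg⟩ * h)
    change op (h : G) • op g • y ∈ W
    rwa [← mul_smul, ← op_mul]
  · have hyW : y ∈ W := by simpa using Set.mem_iInter.1 hy 1
    have hyW' : op g • y ∈ W := by simpa using Set.mem_iInter.1 hy' 1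
    have hg' : g ∈ {g : G | ∃ z ∈ K, op g • z ∈ K} \ X.stabiliser x :=
      ⟨⟨y, interior_subset hyW.1, interior_subset hyW'.1⟩, hg⟩
    exact hNd g hg y (Set.mem_iInter₂.1 hyW.2 g hg') (Set.mem_iInter₂.1 hyW'.2 g hg')

end GMan

/-! ## The upper half-plane as a homogeneous space -/

/-- In determinant one the inverse is the adjugate, so orthogonality compares the entries of the
transpose and the adjugate. -/
theorem mem_SO2_iff {g : SL(2, ℝ)} : g ∈ SO2 ↔ g 0 0 = g 1 1 ∧ g 0 1 = -g 1 0 := by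
  have h1 : g ∈ SO2 ↔ g.transpose = g⁻¹ := by
    rw [eq_inv_iff_mul_eq_one, mul_eq_one_iff_eq_inv', ← inv_eq_iff_eq_inv, eq_comm,
      ← mul_eq_one_iff_eq_inv']
    exact Iff.rfl
  rw [h1, Matrix.SpecialLinearGroup.ext_iff]
  simp [Fin.forall_fin_two, Matrix.SpecialLinearGroup.coe_transpose, Matrix.adjugate_fin_two]
  grind

theorem smul_I_eq_iff {g : SL(2, ℝ)} :
    g • UpperHalfPlane.I = UpperHalfPlane.I ↔ g 0 0 = g 1 1 ∧ g 0 1 = -g 1 0 := by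
  rw [UpperHalfPlane.ext_iff, UpperHalfPlane.coe_specialLinearGroup_apply, div_eq_iff]
  · simp [Complex.ext_iff]
    grind
  · exact UpperHalfPlane.denom_ne_zero (g : GL (Fin 2) ℝ) UpperHalfPlane.I

theorem rightMoebius_I_eq_iff {g : SL(2, ℝ)} :
    rightMoebius UpperHalfPlane.I g = UpperHalfPlane.I ↔ g ∈ SO2 := by
  rw [rightMoebius, smul_I_eq_iff, mem_SO2_iff]
  simp only [Matrix.SpecialLinearGroup.coe_transpose, Matrix.transpose_apply]
  grind

theorem rightMoebius_I_eq_rightMoebius_I_iff {a b : SL(2, ℝ)} :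
    rightMoebius UpperHalfPlane.I a = rightMoebius UpperHalfPlane.I b ↔ b * a⁻¹ ∈ SO2 := by
  rw [← rightMoebius_I_eq_iff, rightMoebius_mul]
  constructor
  · intro h
    rw [← h, ← rightMoebius_mul, mul_inv_cancel, rightMoebius_one]
  · intro h
    nth_rw 1 [← h]
    rw [← rightMoebius_mul, inv_mul_cancel, rightMoebius_one]

theorem continuous_specialLinearGroup_transpose :
    Continuous (Matrix.SpecialLinearGroup.transpose : SL(2, ℝ) → SL(2, ℝ)) :=
  (Continuous.matrix_transpose continuous_subtype_val).subtype_mk _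

/-- The upper half-plane is the homogeneous space `SO(2) \ SL(2, ℝ)`. -/
def orbitHomeomorph : Quotient (QuotientGroup.rightRel SO2) ≃ₜ ℍ where
  toFun := Quotient.lift (rightMoebius UpperHalfPlane.I) fun _ _ h =>
    rightMoebius_I_eq_rightMoebius_I_iff.2 (QuotientGroup.rightRel_apply.1 h)
  -- The matrix `z.toSL2R` sends `i` to `z` and depends continuously on `z`, so continuity of the
  -- inverse needs no open mapping argument; the transpose converts the left action to the right
  -- one.
  invFun z := Quotient.mk _ z.toSL2R.transpose
  left_inv := by
    rintro ⟨g⟩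
    refine Quotient.sound (QuotientGroup.rightRel_apply.2
      (rightMoebius_I_eq_rightMoebius_I_iff.1 ?_))
    exact UpperHalfPlane.toSL2R_smul_I _
  right_inv z := UpperHalfPlane.toSL2R_smul_I z
  continuous_toFun := (continuous_specialLinearGroup_transpose.smul continuous_const).quotient_lift _
  continuous_invFun := continuous_quotient_mk'.comp
    (continuous_specialLinearGroup_transpose.comp UpperHalfPlane.continuous_toSL2R)

/-! ## The modular group -/

theorem modularInclusion_injective : Function.Injective modularInclusion := fun a b h => by
  ext i j
  exact Int.cast_injective (α := ℝ) (congrArg (fun g : SL(2, ℝ) => g i j) h)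

instance countable_modularGroup : Countable SL(2, ℤ) :=
  Function.Injective.countable (f := fun (g : SL(2, ℤ)) (i j : Fin 2) => g i j)
    fun _ _ h => Matrix.SpecialLinearGroup.ext _ _ fun i j => congrFun (congrFun h i) j

theorem modularInclusion_transpose (g : SL(2, ℤ)) :
    modularInclusion g.transpose = (modularInclusion g).transpose := by
  ext i j
  rfl

/-- A discrete subgroup of `SL(2, ℝ)` acts properly discontinuously on `ℍ` from the left. The
injective map `g ↦ gᵗ` carries the right action to this left action, so finiteness pulls back. -/
theorem modularAction_proper (C : Set modularAction.carrier) (hC : IsCompact C) :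
    {g : SL(2, ℤ) | ∃ z ∈ C, op g • z ∈ C}.Finite := by
  have : ProperlyDiscontinuousSMul modularInclusion.range ℍ := by
    have : DiscreteTopology modularInclusion.range :=
      Matrix.SpecialLinearGroup.discreteSpecialLinearGroupIntRangeSL
    infer_instance
  have h := ProperlyDiscontinuousSMul.finite_disjoint_inter_image (Γ := modularInclusion.range)
    (T := ℍ) (K := C) (L := C) hC hC
  let φ : SL(2, ℤ) → modularInclusion.range := fun g => ⟨modularInclusion g.transpose, _, rfl⟩
  have hφ : Function.Injective φ := fun a b hab => by
    have h1 := modularInclusion_injective (congrArg Subtype.val hab)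
    ext i j
    exact congrArg (fun g : SL(2, ℤ) => g j i) h1
  refine (h.preimage hφ.injOn).subset ?_
  rintro g ⟨z, hz, hgz⟩
  refine ⟨_, ⟨z, hz, rfl⟩, ?_⟩
  have h1 : φ g • (id z : ℍ) = rightMoebius z (modularInclusion g) :=
    congrArg (fun k : SL(2, ℝ) => k • (id z : ℍ)) (modularInclusion_transpose g)
  exact Set.mem_of_eq_of_mem h1 hgz

theorem rightMoebius_modularInclusion_neg_one (z : ℍ) :
    rightMoebius z (modularInclusion (-1)) = z := by
  have h : (modularInclusion (-1)).transpose = -1 := by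
    ext i j
    fin_cases i <;> fin_cases j <;> simp [modularInclusion]
  rw [rightMoebius, h, UpperHalfPlane.ext_iff, UpperHalfPlane.coe_specialLinearGroup_apply]
  simp

theorem neg_one_smul_modularAction (z : modularAction.carrier) : op (-1 : SL(2, ℤ)) • z = z :=
  rightMoebius_modularInclusion_neg_one z

end
theorem mainTheorem6 :
    -- the orbit map of `i` identifies `ℍ` with the homogeneous space `SO(2) \ SL(2, ℝ)`
    (∃ Φ : Quotient (QuotientGroup.rightRel SO2) ≃ₜ ℍ,
      ∀ g : SL(2, ℝ), Φ (Quotient.mk _ g) = rightMoebius UpperHalfPlane.I g) ∧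
    -- `SL(2, ℤ)` is a discrete subgroup of `SL(2, ℝ)`
    Function.Injective modularInclusion ∧ DiscreteTopology modularInclusion.range ∧
    -- it acts properly on `ℍ`
    (∀ C : Set modularAction.carrier, IsCompact C →
      {g : SL(2, ℤ) | ∃ z ∈ C, op g • z ∈ C}.Finite) ∧
    -- the action is not effective
    (-1 : SL(2, ℤ)) ≠ 1 ∧ (∀ z : modularAction.carrier, op (-1 : SL(2, ℤ)) • z = z) ∧
    -- slices exist, and stabilisers are finite
    (∀ x : modularAction.carrier,
      Finite (modularAction.stabiliser x) ∧ ∃ U, modularAction.IsSlice x U) ∧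
    -- the canonical morphism from `ℍ` to the quotient stack exists
    (∃ p : modularAction.carrier.stack ⥤ᵇ quotientStack modularAction,
      IsCanonicalAtlas modularAction p) ∧
    ∀ p : modularAction.carrier.stack ⥤ᵇ quotientStack modularAction,
      IsCanonicalAtlas modularAction p →
      -- it is a presentation of the quotient stack as an analytic stack
      IsAnalyticStack (quotientStack modularAction) p ∧
      -- and for all slices `U x`, the canonical morphisms from the stacks `[U x / G_x]` exist
      ∀ (U : modularAction.carrier → Opens modularAction.carrier)
        (hU : ∀ x, modularAction.IsSlice x (U x)),
        (∃ F : ∀ x, quotientStack (modularAction.restrict (modularAction.stabiliser x) (U x)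
            (hU x).invariant) ⥤ᵇ quotientStack modularAction,
          ∀ x, IsExtensionOfStructureGroup (modularAction.stabiliser x).subtype
            (modularAction.carrier.incl (U x)) (F x)) ∧
        ∀ F : ∀ x, quotientStack (modularAction.restrict (modularAction.stabiliser x) (U x)
            (hU x).invariant) ⥤ᵇ quotientStack modularAction,
          (∀ x, IsExtensionOfStructureGroup (modularAction.stabiliser x).subtype
            (modularAction.carrier.incl (U x)) (F x)) →
          -- and make the quotient stack an analytic orbifold
          IsAnalyticOrbifold (quotientStack modularAction) p
            (fun x => modularAction.restrict (modularAction.stabiliser x) (U x)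
              (hU x).invariant) F := by
  refine ⟨⟨orbitHomeomorph, fun _ => rfl⟩, modularInclusion_injective,
    Matrix.SpecialLinearGroup.discreteSpecialLinearGroupIntRangeSL, modularAction_proper,
    by decide, neg_one_smul_modularAction,
    fun x => ⟨modularAction.finite_stabiliser modularAction_proper x,
      modularAction.exists_isSlice modularAction_proper x⟩,
    exists_isCanonicalAtlas modularAction, fun p hp => ⟨hp.isAnalyticStack, fun U hU =>
      ⟨⟨fun x => extensionFunctor _ (isEquivariant_incl _ _ _ (hU x).invariant),
        fun x => isExtensionOfStructureGroup_extensionFunctor _ _⟩,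
      fun F hF => modularAction.isAnalyticOrbifold hp
        (modularAction.finite_stabiliser modularAction_proper) U hU F hF⟩⟩⟩
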